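/- Let $X$ be a locally finite connected graph (undirected, without loops or multiple edges), and let $\Gamma\le \mathrm{AUT}(X)$ be a group of automorphisms acting quasi-transitively, i.e. with finitely many orbits on the vertex set $VX$. If $\Gamma$ contains a parabolic element, then for every $m\ge 1$ there is some $\tau\in\Gamma$ such that $X$ contains a $\tau$-strip of size at least $m$. Here the following terminology is used. - A ray (double ray) is a one-way (two-way) infinite sequence of distinct, successively adjacent vertices. Two rays are equivalent if for every finite set $K$ of vertices all but finitely many vertices of both lie in the same component of $X\setminus K$; ends are the equivalence classes of rays, and $C(K,\omega)$ is the component of $X\setminus K$ in which all rays of the end $\omega$ end up. Automorphisms act on the ends in the obvious way. - A defining sequence for an end $\omega$ is a sequence $(K_n)_{n\ge 0}$ of non-empty finite sets of vertices with $K_n\cup C(K_n,\omega)\subseteq C(K_{n-1},\omega)$ for all $n\ge 1$. The end $\omega$ has finite size $m$ if $m$ is the least number for which $\omega$ has a defining sequence with $|K_n|=m$ for all $n$. - An automorphism is elliptic if it maps some non-empty finite set of vertices onto itself, and parabolic if it is not elliptic and fixes a unique end. - A strip is a locally finite, connected graph $S$ with precisely two ends on which $\mathrm{AUT}(S)$ acts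 quasi-transitively. For an automorphism $\tau$ of $S$, the strip $S$ is called a $\tau$-strip of size $m$ if its two ends can be named $\omega^+,\omega^-$ such that both have size $m$ and there is a set $K$ of $m$ vertices of $S$ such that: $(\tau^nK)_{n\ge0}$ and $(\tau^{-n}K)_{n\ge 0}$ are defining sequences for $\omega^+$ and $\omega^-$, respectively; there are $m$ pairwise disjoint $\tau$-invariant double rays in $S$, each of which meets every $\tau^nK$ ($n\in\mathbb Z$) in precisely one vertex; and the subgraph of $S$ spanned by $\bigl(K\cup C(K,\omega^+)\bigr)\setminus C(\tau K,\omega^+)$ is finite and connected. A double ray is $\tau$-invariant if $\tau$ maps the subgraph formed by its vertices and edges onto itself. - The graph $X$ contains a $\tau$-strip of size $m$, where $\tau\in \mathrm{AUT}(X)$, if $X$ has a subgraph $S$ (not necessarily induced) which $\tau$ maps onto itself and which is a $\sigma$-strip of size $m$ for the restriction $\sigma$ of $\tau$ to $S$. -/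

import Mathlib

namespace GraphStrip

open Filter

universe u

variable {V : Type u}

/-- A graph is locally finite if every vertex has only finitely many neighbours. -/
def IsLocallyFinite (G : SimpleGraph V) : Prop :=
  ∀ v, (G.neighborSet v).Finite

/-- A subgroup of the automorphism group acts quasi-transitively if it has only finitely many
orbits `{γ x : γ ∈ Γ}` on the vertex set. -/
def ActsQuasiTransitively {G : SimpleGraph V} (Γ : Subgroup (G ≃g G)) : Prop :=
  (Set.range fun x : V => {y : V | ∃ γ ∈ Γ, γ x = y}).Finite

/-- The image of a finite set of vertices under an automorphism. -/
def imageFinset {G : SimpleGraph V} (γ : G ≃g G) (K : Finset V) : Finset V :=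
  K.map γ.toEquiv.toEmbedding

/-! ### Rays and ends -/

/-- A ray: a one-way infinite sequence of distinct, successively adjacent vertices. -/
structure Ray (G : SimpleGraph V) where
  /-- the `n`-th vertex -/
  vertex : ℕ → V
  injective : Function.Injective vertex
  adj : ∀ n, G.Adj (vertex n) (vertex (n + 1))

/-- A double ray: a two-way infinite sequence of distinct, successively adjacent vertices. -/
structure DoubleRay (G : SimpleGraph V) where
  /-- the `n`-th vertex -/
  vertex : ℤ → V
  injective : Function.Injective vertex
  adj : ∀ n, G.Adj (vertex n) (vertex (n + 1))

/-- A ray ends up in a component `C` of `G ∖ K` if all but finitely many of its vertices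
lie in `C`. -/
def Ray.EndsUpIn {G : SimpleGraph V} {K : Set V} (r : Ray G) (C : G.ComponentCompl K) : Prop :=
  ∀ᶠ n in atTop, r.vertex n ∈ C

/-- Two rays are equivalent if, for every finite set `K` of vertices, both end up in the same
component of `G ∖ K`. -/
def Ray.Equivalent {G : SimpleGraph V} (r s : Ray G) : Prop :=
  ∀ K : Finset V, ∃ C : G.ComponentCompl (K : Set V), r.EndsUpIn C ∧ s.EndsUpIn C

theorem Ray.exists_endsUpIn {G : SimpleGraph V} (r : Ray G) (K : Finset V) :
    ∃ C : G.ComponentCompl (K : Set V), r.EndsUpIn C := by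
  have h : ∀ᶠ n in atTop, r.vertex n ∉ (K : Set V) := by
    have := r.injective.tendsto_cofinite.eventually K.finite_toSet.compl_mem_cofinite
    rwa [Nat.cofinite_eq_atTop] at this
  obtain ⟨N, hN⟩ := eventually_atTop.1 h
  refine ⟨G.componentComplMk (hN N le_rfl), eventually_atTop.2 ⟨N, fun n hn => ?_⟩⟩
  refine ⟨hN n hn, ?_⟩
  induction n, hn using Nat.le_induction with
  | base => rfl
  | succ n hn ih =>
    rw [← ih]
    exact (SimpleGraph.componentComplMk_eq_of_adj G _ _ (r.adj n)).symm

theorem Ray.endsUpIn_unique {G : SimpleGraph V} {r : Ray G} {K : Set V}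
    {C D : G.ComponentCompl K} (hC : r.EndsUpIn C) (hD : r.EndsUpIn D) : C = D := by
  obtain ⟨n, ⟨_, h1⟩, ⟨_, h2⟩⟩ := (hC.and hD).exists
  exact h1.symm.trans h2

/-- Equivalence of rays is an equivalence relation. -/
def raySetoid (G : SimpleGraph V) : Setoid (Ray G) where
  r := Ray.Equivalent
  iseqv :=
    { refl := fun r K => by
        obtain ⟨C, hC⟩ := r.exists_endsUpIn K
        exact ⟨C, hC, hC⟩
      symm := fun h K => by
        obtain ⟨C, h1, h2⟩ := h K
        exact ⟨C, h2, h1⟩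
      trans := fun h h' K => by
        obtain ⟨C, h1, h2⟩ := h K
        obtain ⟨D, h3, h4⟩ := h' K
        obtain rfl := Ray.endsUpIn_unique h2 h3
        exact ⟨C, h1, h4⟩ }

/-- The ends of a graph: equivalence classes of rays. -/
def GraphEnd (G : SimpleGraph V) : Type u :=
  Quotient (raySetoid G)

/-- The end represented by a ray. -/
def Ray.toEnd {G : SimpleGraph V} (r : Ray G) : GraphEnd G :=
  Quotient.mk (raySetoid G) r

/-- `C(K, ω)`: the vertex set of the component of `G ∖ K` in which all rays representing the
end `ω` end up. -/
def endComponent {G : SimpleGraph V} (K : Finset V) (ω : GraphEnd G) : Set V :=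
  {v | ∃ C : G.ComponentCompl (K : Set V), v ∈ C ∧ ∀ r : Ray G, r.toEnd = ω → r.EndsUpIn C}

/-- A defining sequence for the end `ω`: finite (non-empty) sets `K n` of vertices with
`K (n + 1) ∪ C(K (n + 1), ω) ⊆ C(K n, ω)`. -/
def IsDefiningSequence {G : SimpleGraph V} (ω : GraphEnd G) (K : ℕ → Finset V) : Prop :=
  (∀ n, (K n).Nonempty) ∧
    ∀ n, (K (n + 1) : Set V) ∪ endComponent (K (n + 1)) ω ⊆ endComponent (K n) ω

/-- The end `ω` is thin of size `m`: `m` is the least number such that `ω` has a defining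
sequence all of whose members have exactly `m` elements. -/
def HasSize {G : SimpleGraph V} (ω : GraphEnd G) (m : ℕ) : Prop :=
  IsLeast {k : ℕ | ∃ K : ℕ → Finset V, IsDefiningSequence ω K ∧ ∀ n, (K n).card = k} m

/-! ### Automorphisms -/

/-- The image of a ray under an automorphism. -/
def Ray.map {G : SimpleGraph V} (γ : G ≃g G) (r : Ray G) : Ray G where
  vertex n := γ (r.vertex n)
  injective := γ.injective.comp r.injective
  adj n := γ.map_adj_iff.2 (r.adj n)

theorem Ray.Equivalent.map {G : SimpleGraph V} (γ : G ≃g G) {r s : Ray G}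
    (h : r.Equivalent s) : (r.map γ).Equivalent (s.map γ) := by
  intro K
  obtain ⟨C, hr, hs⟩ := h (imageFinset γ.symm K)
  have hmaps : Set.MapsTo γ ((imageFinset γ.symm K : Finset V) : Set V)ᶜ (K : Set V)ᶜ := by
    intro v hv hK
    refine hv ?_
    simp only [imageFinset, Finset.coe_map, Set.mem_image]
    exact ⟨γ v, hK, γ.symm_apply_apply v⟩
  let φ := SimpleGraph.induceHom γ.toHom hmaps
  have key : ∀ v ∈ C, γ v ∈ (C.map φ : G.ComponentCompl (K : Set V)) := by
    rintro v ⟨hv, rfl⟩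
    exact ⟨hmaps hv, rfl⟩
  exact ⟨C.map φ, hr.mono fun n hn => key _ hn, hs.mono fun n hn => key _ hn⟩

/-- The action of an automorphism on the ends. -/
def GraphEnd.map {G : SimpleGraph V} (γ : G ≃g G) : GraphEnd G → GraphEnd G :=
  Quotient.map' (s₁ := raySetoid G) (s₂ := raySetoid G) (Ray.map γ)
    fun _ _ h => Ray.Equivalent.map γ h

/-- An automorphism is elliptic if it fixes (setwise) a non-empty finite set of vertices. -/
def IsElliptic {G : SimpleGraph V} (γ : G ≃g G) : Prop :=
  ∃ F : Finset V, F.Nonempty ∧ imageFinset γ F = F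

/-- An automorphism is parabolic if it is not elliptic and fixes a unique end. -/
def IsParabolic {G : SimpleGraph V} (γ : G ≃g G) : Prop :=
  ¬ IsElliptic γ ∧ ∃! ω : GraphEnd G, GraphEnd.map γ ω = ω

/-! ### Strips -/

/-- The subgraph consisting of the vertices and the edges of a double ray. -/
def DoubleRay.toSubgraph {G : SimpleGraph V} (ρ : DoubleRay G) : G.Subgraph where
  verts := Set.range ρ.vertex
  Adj a b := ∃ n, (a = ρ.vertex n ∧ b = ρ.vertex (n + 1)) ∨
    (b = ρ.vertex n ∧ a = ρ.vertex (n + 1))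
  adj_sub := by
    rintro a b ⟨n, ⟨rfl, rfl⟩ | ⟨rfl, rfl⟩⟩
    · exact ρ.adj n
    · exact (ρ.adj n).symm
  edge_vert := by
    rintro a b ⟨n, ⟨rfl, _⟩ | ⟨_, rfl⟩⟩
    · exact ⟨n, rfl⟩
    · exact ⟨n + 1, rfl⟩
  symm := ⟨by
    rintro a b ⟨n, h⟩
    exact ⟨n, h.symm⟩⟩

/-- A double ray is invariant under `γ` if `γ` maps the subgraph it spans onto itself. -/
def DoubleRay.IsInvariant {G : SimpleGraph V} (ρ : DoubleRay G) (γ : G ≃g G) : Prop :=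
  ρ.toSubgraph.map γ.toHom = ρ.toSubgraph

/-- A strip: a locally finite, connected, quasi-transitive graph with precisely two ends. -/
structure IsStrip (S : SimpleGraph V) : Prop where
  locallyFinite : IsLocallyFinite S
  connected : S.Connected
  quasiTransitive : ActsQuasiTransitively (⊤ : Subgroup (S ≃g S))
  two_ends : Nat.card (GraphEnd S) = 2

/-- The graph `S`, together with its automorphism `τ`, is a `τ`-strip of size `m`. -/
def IsTauStrip (S : SimpleGraph V) (τ : S ≃g S) (m : ℕ) : Prop :=
  IsStrip S ∧
  ∃ (ωp ωm : GraphEnd S) (K : Finset V),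
    ωp ≠ ωm ∧
    HasSize ωp m ∧ HasSize ωm m ∧
    K.card = m ∧
    IsDefiningSequence ωp (fun n : ℕ => imageFinset (τ ^ n) K) ∧
    IsDefiningSequence ωm (fun n : ℕ => imageFinset (τ⁻¹ ^ n) K) ∧
    (∃ ρ : Fin m → DoubleRay S,
      (∀ i j, i ≠ j → Disjoint (Set.range (ρ i).vertex) (Set.range (ρ j).vertex)) ∧
      (∀ i, (ρ i).IsInvariant τ) ∧
      ∀ i, ∀ n : ℤ, ∃! v, v ∈ Set.range (ρ i).vertex ∧ v ∈ imageFinset (τ ^ n) K) ∧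
    -- the subgraph of `S` spanned by `Y = (K ∪ C(K, ω⁺)) ∖ C(τ K, ω⁺)` is finite and connected
    (((K : Set V) ∪ endComponent K ωp) \ endComponent (imageFinset τ K) ωp).Finite ∧
    (S.induce (((K : Set V) ∪ endComponent K ωp) \
      endComponent (imageFinset τ K) ωp)).Connected

/-- The graph `X` contains a `τ`-strip of size `m`, for an automorphism `τ` of `X`: some subgraph
`S` of `X` is invariant under `τ` and is a `σ`-strip of size `m`, `σ` the restriction of `τ`
to `S`. -/
def ContainsTauStrip (X : SimpleGraph V) (τ : X ≃g X) (m : ℕ) : Prop :=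
  ∃ (S : X.Subgraph) (σ : S.coe ≃g S.coe),
    (∀ v : S.verts, ((σ v : S.verts) : V) = τ v) ∧ IsTauStrip S.coe σ m

end GraphStrip

/-! Let γ be parabolic. No nontrivial power of γ fixes a vertex, so there are height functions with
h (γ v) = h v + 1. Call a double ray shifted if advancing it by some p > 0 steps amounts to applying
some γ ^ N with N > 0. Both tails of a shifted double ray represent ends fixed by γ
(`map_toEnd_of_shift`), hence the same end, so no finite set separates them
(`equivalent_posRay_negRay`).

This produces arbitrarily many disjoint shifted double rays. Given finitely many, let A be the union
of all their γ-translates; it consists of finitely many γ-orbits. Suppose that no vertex outside A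
is joined to a nontrivial translate of itself in G − A. Then each component of G − A attaches to
only finitely many vertices of A, with heights in a range of bounded length, so a finite band of A
around height zero separates the two tails of a shifted double ray in A, which is impossible. Hence
some vertex is joined to a translate outside A (`exists_reachable_translate_compl`), and the
translates of a shortest such walk form a new shifted double ray that avoids A
(`exists_shifted_doubleRay`).

Given m disjoint double rays shifted by one common power, the strip consists of them and the
translates of a finite connected set Q that meets them all. For τ a high enough power, Q fits
between consecutive cuts, each with one vertex per ray, so the graph is a stack of finite layers
glued along the cuts (`IsLayered`). It has two ends, the cuts give defining sequences of size m, and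
the m disjoint rays tending to each end exclude smaller ones (`le_card_of_disjoint_rays`). -/

namespace GraphStrip

open Filter

variable {V : Type*} {G : SimpleGraph V}

/-! ### Reachability within a set of vertices -/

/-- The spanning subgraph of `G` whose edges are those with both endpoints in `A`. -/
def within (G : SimpleGraph V) (A : Set V) : SimpleGraph V where
  Adj u v := G.Adj u v ∧ u ∈ A ∧ v ∈ A
  symm := ⟨fun _ _ h => ⟨h.1.symm, h.2.2, h.2.1⟩⟩
  loopless := ⟨fun _ h => h.1.ne rfl⟩

theorem within_mono {A B : Set V} (h : A ⊆ B) : within G A ≤ within G B :=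
  fun _ _ hab => ⟨hab.1, h hab.2.1, h hab.2.2⟩

theorem reachable_of_adj_closed {P : V → Prop} (hP : ∀ a b, G.Adj a b → P a → P b) {u v : V}
    (h : G.Reachable u v) (hu : P u) : P v := by
  obtain ⟨p⟩ := h
  induction p with
  | nil => exact hu
  | cons hab _ ih => exact ih (hP _ _ hab hu)

theorem within_reachable_mem {A : Set V} {u v : V} (h : (within G A).Reachable u v)
    (hu : u ∈ A) : v ∈ A :=
  reachable_of_adj_closed (G := within G A) (P := (· ∈ A)) (fun _ _ hab _ => hab.2.2) h hu

theorem induce_reachable {A : Set V} {u v : V} (h : (within G A).Reachable u v)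
    (hu : u ∈ A) (hv : v ∈ A) : (G.induce A).Reachable ⟨u, hu⟩ ⟨v, hv⟩ := by
  have := reachable_of_adj_closed (G := within G A)
    (P := fun w => ∃ hw : w ∈ A, (G.induce A).Reachable ⟨u, hu⟩ ⟨w, hw⟩)
    (fun a b hab ⟨ha, hr⟩ => ⟨hab.2.2, hr.trans (SimpleGraph.Adj.reachable (by exact hab.1))⟩)
    h ⟨hu, .rfl⟩
  exact this.2

theorem within_reachable_of_induce {A : Set V} {u v : A} (h : (G.induce A).Reachable u v) :
    (within G A).Reachable u v :=
  reachable_of_adj_closed (G := G.induce A) (P := fun w : A => (within G A).Reachable u w)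
    (fun a b hab hr => hr.trans (SimpleGraph.Adj.reachable ⟨hab, a.2, b.2⟩)) h .rfl

theorem induce_connected {A : Set V} (hne : A.Nonempty)
    (h : ∀ u ∈ A, ∀ v ∈ A, (within G A).Reachable u v) : (G.induce A).Connected where
  preconnected u v := induce_reachable (h u u.2 v v.2) u.2 v.2
  nonempty := hne.to_subtype

theorem mem_component_of_reachable {K : Set V} {C : G.ComponentCompl K} {u v : V} (hu : u ∈ C)
    (h : (within G Kᶜ).Reachable u v) : v ∈ C := by
  obtain ⟨hK, rfl⟩ := hu
  have hv : v ∈ Kᶜ := within_reachable_mem h hK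
  exact ⟨hv, (SimpleGraph.ConnectedComponent.eq.2 (induce_reachable h hK hv)).symm⟩

theorem reachable_of_mem_component {K : Set V} {C : G.ComponentCompl K} {u v : V} (hu : u ∈ C)
    (hv : v ∈ C) : (within G Kᶜ).Reachable u v := by
  obtain ⟨hK, rfl⟩ := hu
  obtain ⟨hK', h⟩ := hv
  exact within_reachable_of_induce (SimpleGraph.ConnectedComponent.eq.1 h.symm)

/-! ### Components of ends -/

theorem toEnd_eq_iff {r s : Ray G} : r.toEnd = s.toEnd ↔ r.Equivalent s :=
  Quotient.eq (r := raySetoid G)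

theorem endComponent_toEnd (r : Ray G) {K : Finset V} {C : G.ComponentCompl (K : Set V)}
    (hC : r.EndsUpIn C) : endComponent K r.toEnd = {v | v ∈ C} := by
  ext v
  constructor
  · rintro ⟨D, hv, hD⟩
    rwa [Set.mem_ofPred_eq, Ray.endsUpIn_unique hC (hD r rfl)]
  · intro hv
    refine ⟨C, hv, fun s hs => ?_⟩
    obtain ⟨D, hD, hD'⟩ := toEnd_eq_iff.1 hs K
    rwa [Ray.endsUpIn_unique hC hD']

/-- A connected set that avoids K and is closed under adjacency outside K is a full component of the
complement of K. This is how the components of the ends of a layered graph are computed. -/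
theorem endComponent_toEnd_eq (r : Ray G) {K : Finset V} {A : Set V}
    (hr : ∀ᶠ n in atTop, r.vertex n ∈ A) (hK : ∀ v ∈ A, v ∉ K)
    (hA : ∀ u ∈ A, ∀ v ∈ A, (within G A).Reachable u v)
    (hcl : ∀ u ∈ A, ∀ v, v ∉ K → G.Adj u v → v ∈ A) : endComponent K r.toEnd = A := by
  obtain ⟨C, hC⟩ := r.exists_endsUpIn K
  rw [endComponent_toEnd r hC]
  obtain ⟨n, hn, hnC⟩ := (hr.and hC).exists
  ext v
  constructor
  · intro hv
    exact reachable_of_adj_closed (G := within G (K : Set V)ᶜ) (P := (· ∈ A))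
      (fun a b hab ha => hcl a ha b (by simpa using hab.2.2) hab.1)
      (reachable_of_mem_component hnC hv) hn
  · intro hv
    exact mem_component_of_reachable hnC
      ((hA _ hn _ hv).mono (within_mono fun w hw => by simpa using hK w hw))

theorem eventually_mem_endComponent (r : Ray G) (K : Finset V) :
    ∀ᶠ n in atTop, r.vertex n ∈ endComponent K r.toEnd := by
  obtain ⟨C, hC⟩ := r.exists_endsUpIn K
  rw [endComponent_toEnd r hC]
  exact hC

theorem notMem_of_mem_endComponent {K : Finset V} {ω : GraphEnd G} {v : V}
    (hv : v ∈ endComponent K ω) : v ∉ K := by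
  obtain ⟨C, ⟨h, -⟩, -⟩ := hv
  simpa using h

theorem mem_endComponent_of_adj {K : Finset V} {ω : GraphEnd G} {u v : V}
    (hu : u ∈ endComponent K ω) (hv : v ∉ K) (h : G.Adj u v) : v ∈ endComponent K ω := by
  obtain ⟨C, hC, hr⟩ := hu
  exact ⟨C, C.mem_of_adj u v hC (by simpa using hv) h, hr⟩

theorem equivalent_of_eventually {r s : Ray G}
    (h : ∀ K : Finset V, ∀ᶠ n in atTop,
      (within G (K : Set V)ᶜ).Reachable (r.vertex n) (s.vertex n)) : r.Equivalent s := by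
  intro K
  obtain ⟨C, hC⟩ := r.exists_endsUpIn K
  refine ⟨C, hC, ?_⟩
  filter_upwards [hC, h K] with n hn hK
  exact mem_component_of_reachable hn hK

/-! ### Disjoint rays bound the size of an end from below -/

theorem endComponent_succ_subset {ω : GraphEnd G} {F : ℕ → Finset V}
    (hF : IsDefiningSequence ω F) (n : ℕ) : endComponent (F (n + 1)) ω ⊆ endComponent (F n) ω :=
  Set.subset_union_right.trans (hF.2 n)

/-- The property holds for a vertex of F 0, and it spreads along edges: if a is adjacent to b in C(F
(n + 1), ω), then a lies in F (n + 1) or in C(F (n + 1), ω), hence in C(F n, ω). -/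
theorem eventually_notMem_endComponent (hG : G.Connected) {ω : GraphEnd G} {F : ℕ → Finset V}
    (hF : IsDefiningSequence ω F) (v : V) : ∀ᶠ n in atTop, v ∉ endComponent (F n) ω := by
  obtain ⟨f, hf⟩ := hF.1 0
  have hanti : Antitone fun n => endComponent (F n) ω :=
    antitone_nat_of_succ_le fun n => endComponent_succ_subset hF n
  refine reachable_of_adj_closed (P := fun v => ∀ᶠ n in atTop, v ∉ endComponent (F n) ω)
    (fun a b hab ha => ?_) (hG.preconnected f v) ?_
  · obtain ⟨N, hN⟩ := eventually_atTop.1 ha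
    refine eventually_atTop.2 ⟨N + 1, fun n hn hb => ?_⟩
    obtain ⟨n, rfl⟩ : ∃ k, n = k + 1 := ⟨n - 1, by omega⟩
    by_cases haF : a ∈ F (n + 1)
    · exact hN n (by omega) (hF.2 n (Or.inl haF))
    · exact hN (n + 1) (by omega) (mem_endComponent_of_adj hb haF hab.symm)
  · exact Eventually.of_forall fun n hn => notMem_of_mem_endComponent (hanti (Nat.zero_le n) hn) hf

/-- Far out in the defining sequence all m rays start outside C(F n, ω) and end up inside, so each
meets F n, in vertices that are distinct by disjointness. -/
theorem le_card_of_disjoint_rays (hG : G.Connected) {ω : GraphEnd G} {F : ℕ → Finset V}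
    (hF : IsDefiningSequence ω F) {m k : ℕ} (hk : ∀ n, (F n).card = k) (r : Fin m → Ray G)
    (hr : ∀ i, (r i).toEnd = ω)
    (hdisj : ∀ i j, i ≠ j → ∀ a b, (r i).vertex a ≠ (r j).vertex b) : m ≤ k := by
  obtain ⟨n, hn⟩ : ∃ n, ∀ i, (r i).vertex 0 ∉ endComponent (F n) ω :=
    (eventually_all.2 fun i => eventually_notMem_endComponent hG hF ((r i).vertex 0)).exists
  have hmeet : ∀ i, ∃ j, (r i).vertex j ∈ F n := by
    intro i
    by_contra! hno
    have : ∀ j, (r i).vertex j ∉ endComponent (F n) ω := by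
      intro j
      induction j with
      | zero => exact hn i
      | succ j ih => exact fun hj => ih (mem_endComponent_of_adj hj (hno j) ((r i).adj j).symm)
    obtain ⟨j, hj⟩ := (eventually_mem_endComponent (r i) (F n)).exists
    exact this j (hr i ▸ hj)
  choose j hj using hmeet
  rw [← hk n, ← Fintype.card_fin m, ← Finset.card_univ]
  refine Finset.card_le_card_of_injOn (fun i => (r i).vertex (j i)) (fun i _ => hj i) ?_
  intro a _ b _ hab
  by_contra hne
  exact hdisj a b hne _ _ hab

/-! ### Powers of an automorphism -/

theorem zpow_add_apply (γ : G ≃g G) (a b : ℤ) (v : V) :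
    (γ ^ (a + b)) v = (γ ^ a) ((γ ^ b) v) := by
  rw [zpow_add]; rfl

theorem zpow_neg_apply_self (γ : G ≃g G) (a : ℤ) (v : V) : (γ ^ (-a)) ((γ ^ a) v) = v := by
  rw [← zpow_add_apply]; simp

theorem zpow_apply_neg_self (γ : G ≃g G) (a : ℤ) (v : V) : (γ ^ a) ((γ ^ (-a)) v) = v := by
  rw [← zpow_add_apply]; simp

theorem zpow_one_add_apply (γ : G ≃g G) (a : ℤ) (v : V) :
    (γ ^ (1 + a)) v = γ ((γ ^ a) v) := by
  rw [zpow_add_apply, zpow_one]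

theorem apply_zpow_of_map {γ : G ≃g G} {h : V → ℤ} (hγ : ∀ v, h (γ v) = h v + 1) (n : ℤ) (v : V) :
    h ((γ ^ n) v) = h v + n := by
  induction n with
  | zero => simp
  | succ n ih =>
    rw [add_comm (n : ℤ) 1, zpow_one_add_apply, hγ, ih]; ring
  | pred n ih =>
    have := hγ ((γ ^ (-(n : ℤ) - 1)) v)
    rw [← zpow_one_add_apply γ (-(n : ℤ) - 1) v] at this
    have e : (1 : ℤ) + (-(n : ℤ) - 1) = -n := by ring
    rw [e, ih] at this
    linarith

theorem zpow_apply_of_shift {γ : G ≃g G} {L : ℤ → V} {p : ℤ} (hL : ∀ j, L (j + p) = γ (L j))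
    (n j : ℤ) : (γ ^ n) (L j) = L (j + n * p) := by
  induction n with
  | zero => simp
  | succ n ih =>
    rw [add_comm (n : ℤ) 1, zpow_one_add_apply, ih, ← hL]; congr 1; ring
  | pred n ih =>
    apply γ.injective
    rw [← zpow_one_add_apply γ (-(n : ℤ) - 1), ← hL]
    have e : (1 : ℤ) + (-(n : ℤ) - 1) = -n := by ring
    rw [e, ih]; congr 1; ring

theorem mem_imageFinset {γ : G ≃g G} {K : Finset V} {v : V} :
    v ∈ imageFinset γ K ↔ ∃ k ∈ K, γ k = v := by
  simp only [imageFinset, Finset.mem_map]; rfl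

theorem within_reachable_map (γ : G ≃g G) {A B : Set V} (h : ∀ a ∈ A, γ a ∈ B) {u v : V}
    (huv : (within G A).Reachable u v) : (within G B).Reachable (γ u) (γ v) :=
  reachable_of_adj_closed (G := within G A) (P := fun w => (within G B).Reachable (γ u) (γ w))
    (fun a b hab hr => hr.trans
      (SimpleGraph.Adj.reachable ⟨γ.map_adj_iff.2 hab.1, h a hab.2.1, h b hab.2.2⟩)) huv .rfl

/-! ### Layered graphs -/

theorem exists_height_bound (F : Finset V) (h : V → ℤ) :
    ∃ N : ℤ, 0 ≤ N ∧ ∀ v ∈ F, -N < h v ∧ h v < N := by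
  obtain ⟨N, hN⟩ := (F.image fun v => |h v|).bddAbove
  refine ⟨max N 0 + 1, by positivity, fun v hv => ?_⟩
  have : |h v| ≤ N := hN (by simpa using ⟨v, hv, rfl⟩)
  have := abs_le.1 this
  have := le_max_left N 0
  constructor <;> omega

/-- A graph with an automorphism `τ` that shifts a height function `h` with finite levels by one,
such that adjacent levels are joined only through the translates of a finite set `K` of vertices
of height zero, and such that the remainder of each level is connected and attached to the
translates of `K` just below and just above it. -/
structure IsLayered (G : SimpleGraph V) (τ : G ≃g G) (h : V → ℤ) (K : Finset V) : Prop where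
  height_map : ∀ v, h (τ v) = h v + 1
  finite_level : {v | h v = 0}.Finite
  nonempty : K.Nonempty
  height_cut : ∀ k ∈ K, h k = 0
  height_adj : ∀ u v, G.Adj u v → h u ≤ h v →
    h u = h v ∨ (h v = h u + 1 ∧ v ∈ imageFinset (τ ^ h v) K)
  core_reachable : ∀ u v, h u = 0 → u ∉ K → h v = 0 → v ∉ K →
    (within G {w | h w = 0 ∧ w ∉ K}).Reachable u v
  exists_adj_up : ∀ k ∈ K, ∃ u, h u = 0 ∧ u ∉ K ∧ G.Adj k u
  exists_adj_down : ∀ k ∈ K, ∃ u, h u = 0 ∧ u ∉ K ∧ G.Adj (τ k) u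

namespace IsLayered

variable {τ : G ≃g G} {h : V → ℤ} {K : Finset V}

theorem height_zpow (H : IsLayered G τ h K) (n : ℤ) (v : V) : h ((τ ^ n) v) = h v + n :=
  apply_zpow_of_map H.height_map n v

theorem mem_cut_neg {n : ℤ} {v : V} : v ∈ imageFinset (τ ^ n) K ↔ (τ ^ (-n)) v ∈ K := by
  constructor
  · intro hv
    obtain ⟨k, hk, rfl⟩ := mem_imageFinset.1 hv
    rwa [zpow_neg_apply_self]
  · intro hv
    exact mem_imageFinset.2 ⟨_, hv, zpow_apply_neg_self τ n v⟩

theorem height_of_mem_cut (H : IsLayered G τ h K) {n : ℤ} {v : V}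
    (hv : v ∈ imageFinset (τ ^ n) K) : h v = n := by
  obtain ⟨k, hk, rfl⟩ := mem_imageFinset.1 hv
  rw [H.height_zpow, H.height_cut k hk, zero_add]

theorem level_finite (H : IsLayered G τ h K) (n : ℤ) : {v | h v = n}.Finite := by
  refine (H.finite_level.image (τ ^ n)).subset fun v hv => ⟨(τ ^ (-n)) v, ?_, ?_⟩
  · have : h v = n := hv
    change h _ = 0
    rw [H.height_zpow, this, add_neg_cancel]
  · exact zpow_apply_neg_self τ n v

theorem levels_finite (H : IsLayered G τ h K) (a b : ℤ) : {v | a ≤ h v ∧ h v ≤ b}.Finite := by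
  refine ((Set.finite_Icc a b).biUnion fun n _ => H.level_finite n).subset fun v hv => ?_
  exact Set.mem_biUnion (x := h v) hv rfl

theorem level_reachable (H : IsLayered G τ h K) {n : ℤ} {u v : V} (hu : h u = n)
    (hu' : u ∉ imageFinset (τ ^ n) K) (hv : h v = n) (hv' : v ∉ imageFinset (τ ^ n) K) :
    (within G {w | h w = n ∧ w ∉ imageFinset (τ ^ n) K}).Reachable u v := by
  rw [mem_cut_neg] at hu' hv'
  have := H.core_reachable _ _ (by rw [H.height_zpow, hu]; ring) hu'
    (by rw [H.height_zpow, hv]; ring) hv'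
  have := within_reachable_map (τ ^ n)
    (B := {w | h w = n ∧ w ∉ imageFinset (τ ^ n) K}) (fun a ha => ?_) this
  · rwa [zpow_apply_neg_self, zpow_apply_neg_self] at this
  · refine ⟨by rw [H.height_zpow, ha.1, zero_add], ?_⟩
    rw [mem_cut_neg, zpow_neg_apply_self]
    exact ha.2

theorem exists_adj_level (H : IsLayered G τ h K) {v : V} (hv : v ∈ imageFinset (τ ^ h v) K) :
    ∃ u, h u = h v ∧ u ∉ imageFinset (τ ^ h v) K ∧ G.Adj v u := by
  obtain ⟨k, hk, hkv⟩ := mem_imageFinset.1 hv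
  obtain ⟨u, hu, huK, hadj⟩ := H.exists_adj_up k hk
  refine ⟨(τ ^ h v) u, by rw [H.height_zpow, hu, zero_add], ?_, ?_⟩
  · rwa [mem_cut_neg, zpow_neg_apply_self]
  · have := (τ ^ h v).map_adj_iff.2 hadj
    rwa [hkv] at this

theorem exists_adj_level_below (H : IsLayered G τ h K) {v : V}
    (hv : v ∈ imageFinset (τ ^ h v) K) :
    ∃ u, h u = h v - 1 ∧ u ∉ imageFinset (τ ^ (h v - 1)) K ∧ G.Adj v u := by
  obtain ⟨k, hk, hkv⟩ := mem_imageFinset.1 hv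
  obtain ⟨u, hu, huK, hadj⟩ := H.exists_adj_down k hk
  refine ⟨(τ ^ (h v - 1)) u, by rw [H.height_zpow, hu, zero_add], ?_, ?_⟩
  · rwa [mem_cut_neg, zpow_neg_apply_self]
  · have := (τ ^ (h v - 1)).map_adj_iff.2 hadj
    have e : (τ ^ (h v - 1)) (τ k) = (τ ^ (h v - 1 + 1)) k := by rw [zpow_add_apply, zpow_one]
    rwa [e, sub_add_cancel, hkv] at this

theorem exists_level (H : IsLayered G τ h K) (n : ℤ) :
    ∃ w, h w = n ∧ w ∉ imageFinset (τ ^ n) K := by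
  obtain ⟨k, hk⟩ := H.nonempty
  obtain ⟨u, hu, huK, -⟩ := H.exists_adj_up k hk
  refine ⟨(τ ^ n) u, by rw [H.height_zpow, hu, zero_add], ?_⟩
  rwa [mem_cut_neg, zpow_neg_apply_self]

/-- A union of consecutive levels, possibly without the cut at the bottom and possibly with the
next cut at the top, is connected. -/
theorem reachable (H : IsLayered G τ h K) {A : Set V} {I : Set ℤ} (hI : I.OrdConnected)
    (h1 : ∀ v, h v ∈ I → v ∉ imageFinset (τ ^ h v) K → v ∈ A)
    (h2 : ∀ v, h v ∈ I → h v - 1 ∈ I → v ∈ A)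
    (h3 : ∀ v ∈ A, h v ∈ I ∨ (v ∈ imageFinset (τ ^ h v) K ∧ h v - 1 ∈ I)) :
    ∀ u ∈ A, ∀ v ∈ A, (within G A).Reachable u v := by
  -- Every vertex of A is joined to a base vertex w n off the cut of a level n in I, and consecutive
  -- base vertices are joined through a vertex of the cut of the upper level.
  choose w hw hwK using H.exists_level
  have hlevel : ∀ n ∈ I, ∀ v, h v = n → v ∉ imageFinset (τ ^ n) K →
      (within G A).Reachable v (w n) := fun n hn v hv hvK =>
    (H.level_reachable hv hvK (hw n) (hwK n)).mono
      (within_mono fun x (hx : h x = n ∧ _) => h1 x (hx.1 ▸ hn) (by rw [hx.1]; exact hx.2))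
  have hall : ∀ v ∈ A, ∃ n ∈ I, (within G A).Reachable v (w n) := by
    intro v hv
    by_cases hvI : h v ∈ I
    · refine ⟨h v, hvI, ?_⟩
      by_cases hvK : v ∈ imageFinset (τ ^ h v) K
      · obtain ⟨u, hu, huK, hadj⟩ := H.exists_adj_level hvK
        have huA : u ∈ A := h1 u (hu ▸ hvI) (by rwa [hu])
        exact (SimpleGraph.Adj.reachable (G := within G A) ⟨hadj, hv, huA⟩).trans
          (hlevel _ hvI u hu huK)
      · exact hlevel _ hvI v rfl hvK
    · obtain ⟨hvK, hvI⟩ := (h3 v hv).resolve_left hvI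
      obtain ⟨u, hu, huK, hadj⟩ := H.exists_adj_level_below hvK
      have huA : u ∈ A := h1 u (hu ▸ hvI) (by rwa [hu])
      exact ⟨_, hvI, (SimpleGraph.Adj.reachable (G := within G A) ⟨hadj, hv, huA⟩).trans
          (hlevel _ hvI u hu huK)⟩
  have hstep : ∀ n, n ∈ I → n + 1 ∈ I → (within G A).Reachable (w n) (w (n + 1)) := by
    intro n hn hn'
    obtain ⟨k, hk⟩ := H.nonempty
    set v := (τ ^ (n + 1)) k with hvdef
    have hvK' : v ∈ imageFinset (τ ^ (n + 1)) K := mem_imageFinset.2 ⟨k, hk, rfl⟩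
    have hhv : h v = n + 1 := H.height_of_mem_cut hvK'
    have hvK : v ∈ imageFinset (τ ^ h v) K := by rwa [hhv]
    have hvA : v ∈ A := h2 v (by rwa [hhv]) (by rwa [hhv, add_sub_cancel_right])
    obtain ⟨u, hu, huK, hadj⟩ := H.exists_adj_level hvK
    obtain ⟨u', hu', huK', hadj'⟩ := H.exists_adj_level_below hvK
    rw [hhv] at hu huK
    rw [hhv, add_sub_cancel_right] at hu' huK'
    have huA : u ∈ A := h1 u (hu ▸ hn') (by rwa [hu])
    have huA' : u' ∈ A := h1 u' (hu' ▸ hn) (by rwa [hu'])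
    refine (hlevel n hn u' hu' huK').symm.trans (.trans ?_ (hlevel _ hn' u hu huK))
    exact (SimpleGraph.Adj.reachable (G := within G A) ⟨hadj'.symm, huA', hvA⟩).trans
      (SimpleGraph.Adj.reachable (G := within G A) ⟨hadj, hvA, huA⟩)
  have hbase : ∀ n m, n ≤ m → n ∈ I → m ∈ I → (within G A).Reachable (w n) (w m) := by
    intro n m hnm hn
    induction m, hnm using Int.leInduction with
    | base => intro _; exact .rfl
    | succ m hm ih =>
      intro hm'
      have hmI : m ∈ I := hI.out hn hm' ⟨hm, by omega⟩
      exact (ih hmI).trans (hstep m hmI hm')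
  intro u hu v hv
  obtain ⟨n, hn, hun⟩ := hall u hu
  obtain ⟨m, hm, hvm⟩ := hall v hv
  refine hun.trans (.trans ?_ hvm.symm)
  rcases le_total n m with hnm | hnm
  · exact hbase n m hnm hn hm
  · exact (hbase m n hnm hm hn).symm

theorem locallyFinite (H : IsLayered G τ h K) : IsLocallyFinite G := by
  intro v
  refine (H.levels_finite (h v - 1) (h v + 1)).subset fun u hu => ?_
  rcases le_total (h v) (h u) with hle | hle
  · rcases H.height_adj v u hu hle with h' | h' <;> constructor <;> omega
  · rcases H.height_adj u v (SimpleGraph.Adj.symm hu) hle with h' | h' <;> constructor <;> omega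

theorem connected (H : IsLayered G τ h K) : G.Connected where
  preconnected u v := (H.reachable (A := Set.univ) (I := Set.univ) Set.ordConnected_univ
    (by simp) (by simp) (by simp) u trivial v trivial).mono
    fun _ _ (h : G.Adj _ _ ∧ _) => h.1
  nonempty := let ⟨k, _⟩ := H.nonempty; ⟨k⟩

theorem quasiTransitive (H : IsLayered G τ h K) :
    ActsQuasiTransitively (⊤ : Subgroup (G ≃g G)) := by
  refine (H.finite_level.image fun x : V => {y : V | ∃ γ ∈ (⊤ : Subgroup (G ≃g G)), γ x = y}).subset
    ?_
  rintro _ ⟨x, rfl⟩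
  refine ⟨(τ ^ (-h x)) x, (H.height_zpow _ _).trans (add_neg_cancel _), ?_⟩
  ext y
  constructor
  · rintro ⟨γ, -, rfl⟩
    exact ⟨γ * τ ^ (-h x), trivial, rfl⟩
  · rintro ⟨γ, -, rfl⟩
    refine ⟨γ * τ ^ (h x), trivial, ?_⟩
    change γ ((τ ^ h x) ((τ ^ (-h x)) x)) = _
    rw [zpow_apply_neg_self]

/-- A ray leaves every finite band of levels for good, and its height changes by at most one per
step. So once it has left level zero it stays on one side. -/
theorem tendsto_height (H : IsLayered G τ h K) (r : Ray G) :
    (∀ n : ℤ, ∀ᶠ j in atTop, n ≤ h (r.vertex j)) ∨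
      ∀ n : ℤ, ∀ᶠ j in atTop, h (r.vertex j) < n := by
  have hout : ∀ a b : ℤ, ∀ᶠ j in atTop, ¬ (a ≤ h (r.vertex j) ∧ h (r.vertex j) ≤ b) := by
    intro a b
    have := r.injective.tendsto_cofinite.eventually (H.levels_finite a b).compl_mem_cofinite
    rwa [Nat.cofinite_eq_atTop] at this
  have hstep : ∀ j, h (r.vertex (j + 1)) ≤ h (r.vertex j) + 1 ∧
      h (r.vertex j) ≤ h (r.vertex (j + 1)) + 1 := by
    intro j
    rcases le_total (h (r.vertex j)) (h (r.vertex (j + 1))) with hle | hle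
    · rcases H.height_adj _ _ (r.adj j) hle with h' | h' <;> constructor <;> omega
    · rcases H.height_adj _ _ (r.adj j).symm hle with h' | h' <;> constructor <;> omega
  obtain ⟨N, hN⟩ := eventually_atTop.1 (hout 0 0)
  rcases lt_or_ge (h (r.vertex N)) 0 with hneg | hpos
  · right
    have hneg' : ∀ j ≥ N, h (r.vertex j) < 0 := by
      intro j hj
      induction j, hj using Nat.le_induction with
      | base => exact hneg
      | succ j hj ih => have := hN (j + 1) (by omega); have := hstep j; omega
    intro n
    filter_upwards [hout n 0, eventually_ge_atTop N] with j hj hjN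
    have := hneg' j hjN
    omega
  · left
    have hpos' : ∀ j ≥ N, 0 ≤ h (r.vertex j) := by
      intro j hj
      induction j, hj using Nat.le_induction with
      | base => exact hpos
      | succ j hj ih => have := hN j hj; have := hstep j; omega
    intro n
    filter_upwards [hout 0 (n - 1), eventually_ge_atTop N] with j hj hjN
    have := hpos' j hjN
    omega

theorem reachable_ge (H : IsLayered G τ h K) (n : ℤ) : ∀ u ∈ {v | n ≤ h v}, ∀ v ∈ {v | n ≤ h v},
    (within G {v | n ≤ h v}).Reachable u v :=
  H.reachable (I := Set.Ici n) Set.ordConnected_Ici (fun _ hv _ => hv) (fun _ hv _ => hv)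
    fun _ hv => Or.inl hv

theorem reachable_lt (H : IsLayered G τ h K) (n : ℤ) : ∀ u ∈ {v | h v < n}, ∀ v ∈ {v | h v < n},
    (within G {v | h v < n}).Reachable u v :=
  H.reachable (I := Set.Iio n) Set.ordConnected_Iio (fun _ hv _ => hv) (fun _ hv _ => hv)
    fun _ hv => Or.inl hv

theorem equivalent_of_tendsto_top (H : IsLayered G τ h K) {r s : Ray G}
    (hr : ∀ n : ℤ, ∀ᶠ j in atTop, n ≤ h (r.vertex j))
    (hs : ∀ n : ℤ, ∀ᶠ j in atTop, n ≤ h (s.vertex j)) : r.Equivalent s := by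
  refine equivalent_of_eventually fun F => ?_
  obtain ⟨N, -, hN⟩ := exists_height_bound F h
  filter_upwards [hr N, hs N] with j hj hj'
  refine (H.reachable_ge N _ hj _ hj').mono (within_mono fun v hv hvF => ?_)
  exact absurd (hN v hvF).2 (not_lt.2 hv)

theorem equivalent_of_tendsto_bot (H : IsLayered G τ h K) {r s : Ray G}
    (hr : ∀ n : ℤ, ∀ᶠ j in atTop, h (r.vertex j) < n)
    (hs : ∀ n : ℤ, ∀ᶠ j in atTop, h (s.vertex j) < n) : r.Equivalent s := by
  refine equivalent_of_eventually fun F => ?_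
  obtain ⟨N, -, hN⟩ := exists_height_bound F h
  filter_upwards [hr (-N), hs (-N)] with j hj hj'
  refine (H.reachable_lt (-N) _ hj _ hj').mono (within_mono fun v hv hvF => ?_)
  exact absurd (hN v hvF).1 (not_lt.2 (le_of_lt hv))

/-- Edges entering level n from below end in the cut, so deleting the cut detaches the rest of the
levels from n upwards. -/
theorem endComponent_top (H : IsLayered G τ h K) {r : Ray G}
    (hr : ∀ n : ℤ, ∀ᶠ j in atTop, n ≤ h (r.vertex j)) (n : ℤ) :
    endComponent (imageFinset (τ ^ n) K) r.toEnd =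
      {v | n ≤ h v ∧ v ∉ imageFinset (τ ^ n) K} := by
  refine endComponent_toEnd_eq r ?_ (fun v hv => hv.2) ?_ ?_
  · filter_upwards [hr (n + 1)] with j hj
    refine ⟨by omega, fun hK => ?_⟩
    have := H.height_of_mem_cut hK
    omega
  · refine H.reachable (I := Set.Ici n) Set.ordConnected_Ici ?_ ?_ fun _ hv => Or.inl hv.1
    · intro v hv hvK
      refine ⟨hv, fun hK => hvK ?_⟩
      rwa [H.height_of_mem_cut hK]
    · intro v hv hv'
      refine ⟨hv, fun hK => ?_⟩
      have := H.height_of_mem_cut hK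
      simp only [Set.mem_Ici] at hv'
      omega
  · rintro u ⟨hu, huK⟩ v hvK hadj
    refine ⟨?_, hvK⟩
    by_contra hlt
    rcases H.height_adj v u hadj.symm (by omega) with h' | ⟨h', hmem⟩
    · omega
    · have : h u = n := by omega
      exact huK (this ▸ hmem)

/-- The cut belongs to level n itself, so here, unlike on the upper side, no vertex has to be
removed. -/
theorem endComponent_bot (H : IsLayered G τ h K) {r : Ray G}
    (hr : ∀ n : ℤ, ∀ᶠ j in atTop, h (r.vertex j) < n) (n : ℤ) :
    endComponent (imageFinset (τ ^ n) K) r.toEnd = {v | h v < n} := by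
  refine endComponent_toEnd_eq r (hr n) (fun v hv hvK => ?_) (H.reachable_lt n) ?_
  · exact hv.ne (H.height_of_mem_cut hvK)
  · intro u hu v hvK hadj
    have hu : h u < n := hu
    change h v < n
    by_contra hlt
    rcases H.height_adj u v hadj (by omega) with h' | ⟨h', hmem⟩
    · omega
    · have : h v = n := by omega
      exact hvK (this ▸ hmem)

theorem toEnd_ne (H : IsLayered G τ h K) {r s : Ray G}
    (hr : ∀ n : ℤ, ∀ᶠ j in atTop, n ≤ h (r.vertex j))
    (hs : ∀ n : ℤ, ∀ᶠ j in atTop, h (s.vertex j) < n) : r.toEnd ≠ s.toEnd := by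
  intro heq
  have := eventually_mem_endComponent s (imageFinset (τ ^ (0 : ℤ)) K)
  rw [← heq, H.endComponent_top hr] at this
  obtain ⟨j, hj, hj'⟩ := (this.and (hs 0)).exists
  exact absurd hj.1 (not_le.2 hj')

theorem card_ends (H : IsLayered G τ h K) {r s : Ray G}
    (hr : ∀ n : ℤ, ∀ᶠ j in atTop, n ≤ h (r.vertex j))
    (hs : ∀ n : ℤ, ∀ᶠ j in atTop, h (s.vertex j) < n) : Nat.card (GraphEnd G) = 2 := by
  refine Nat.card_eq_two_iff.2 ⟨r.toEnd, s.toEnd, H.toEnd_ne hr hs, ?_⟩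
  refine Set.eq_univ_of_forall fun ω => ?_
  induction ω using Quotient.inductionOn with
  | h q =>
    rcases H.tendsto_height q with hq | hq
    · exact Or.inl (toEnd_eq_iff.2 (H.equivalent_of_tendsto_top hq hr))
    · exact Or.inr (toEnd_eq_iff.2 (H.equivalent_of_tendsto_bot hq hs))

theorem cut_nonempty (H : IsLayered G τ h K) (n : ℤ) : (imageFinset (τ ^ n) K).Nonempty :=
  Finset.map_nonempty.2 H.nonempty

theorem isDefiningSequence_top (H : IsLayered G τ h K) {r : Ray G}
    (hr : ∀ n : ℤ, ∀ᶠ j in atTop, n ≤ h (r.vertex j)) :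
    IsDefiningSequence r.toEnd fun n : ℕ => imageFinset (τ ^ n) K := by
  simp only [← zpow_natCast]
  refine ⟨fun n => H.cut_nonempty _, fun n => ?_⟩
  rw [H.endComponent_top hr, H.endComponent_top hr]
  have key : ∀ v, ((n + 1 : ℕ) : ℤ) ≤ h v →
      v ∈ {v | (n : ℤ) ≤ h v ∧ v ∉ imageFinset (τ ^ (n : ℤ)) K} := by
    intro v hv
    refine ⟨by omega, fun hvK => ?_⟩
    have := H.height_of_mem_cut hvK
    omega
  rintro v (hv | hv)
  · exact key v (H.height_of_mem_cut hv).ge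
  · exact key v hv.1

theorem isDefiningSequence_bot (H : IsLayered G τ h K) {r : Ray G}
    (hr : ∀ n : ℤ, ∀ᶠ j in atTop, h (r.vertex j) < n) :
    IsDefiningSequence r.toEnd fun n : ℕ => imageFinset (τ⁻¹ ^ n) K := by
  have e : ∀ n : ℕ, τ⁻¹ ^ n = τ ^ (-(n : ℤ)) := fun n => by simp
  simp only [e]
  refine ⟨fun n => H.cut_nonempty _, fun n => ?_⟩
  rw [H.endComponent_bot hr, H.endComponent_bot hr]
  rintro v (hv | hv)
  · have := H.height_of_mem_cut hv
    change h v < _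
    omega
  · change h v < _ at hv
    change h v < _
    omega

end IsLayered

/-! ### Layered graphs with invariant double rays are strips -/

/-- The ray formed by the vertices of non-negative index of a double ray. -/
def DoubleRay.posRay (ρ : DoubleRay G) : Ray G where
  vertex n := ρ.vertex n
  injective := ρ.injective.comp Nat.cast_injective
  adj n := by simpa using ρ.adj n

/-- The ray formed by the vertices of non-positive index of a double ray. -/
def DoubleRay.negRay (ρ : DoubleRay G) : Ray G where
  vertex n := ρ.vertex (-n)
  injective := ρ.injective.comp (neg_injective.comp Nat.cast_injective)
  adj n := by
    have := (ρ.adj (-((n + 1 : ℕ) : ℤ))).symm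
    have e : -((n + 1 : ℕ) : ℤ) + 1 = -(n : ℤ) := by push_cast; ring
    rwa [e] at this

theorem DoubleRay.isInvariant_of_shift {ρ : DoubleRay G} {τ : G ≃g G} {p : ℤ}
    (h : ∀ j, ρ.vertex (j + p) = τ (ρ.vertex j)) : ρ.IsInvariant τ := by
  have h' : ∀ j, ρ.vertex j = τ (ρ.vertex (j - p)) := fun j => by rw [← h, sub_add_cancel]
  refine SimpleGraph.Subgraph.ext ?_ ?_
  · ext v
    constructor
    · rintro ⟨_, ⟨j, rfl⟩, rfl⟩
      exact ⟨j + p, h j⟩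
    · rintro ⟨j, rfl⟩
      exact ⟨_, ⟨j - p, rfl⟩, (h' j).symm⟩
  · funext a b
    refine propext ⟨?_, ?_⟩
    · rintro ⟨c, d, ⟨n, hn⟩, rfl, rfl⟩
      have e : n + p + 1 = n + 1 + p := by ring
      refine ⟨n + p, ?_⟩
      rw [e, h, h]
      rcases hn with ⟨rfl, rfl⟩ | ⟨rfl, rfl⟩
      · exact Or.inl ⟨rfl, rfl⟩
      · exact Or.inr ⟨rfl, rfl⟩
    · rintro ⟨n, hn⟩
      have e : n + 1 - p = n - p + 1 := by ring
      rw [h' n, h' (n + 1), e] at hn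
      rcases hn with ⟨rfl, rfl⟩ | ⟨rfl, rfl⟩
      · exact ⟨_, _, ⟨n - p, Or.inl ⟨rfl, rfl⟩⟩, rfl, rfl⟩
      · exact ⟨_, _, ⟨n - p, Or.inr ⟨rfl, rfl⟩⟩, rfl, rfl⟩

/-- The cuts bound the sizes of both ends by m from above and the rays bound them from below. The
rounded-down quotient in `hh` means that ray i runs through level n from index n * p i, its only
vertex in that cut, to just before the next cut. -/
theorem IsLayered.isTauStrip {τ : G ≃g G} {h : V → ℤ} {K : Finset V} (H : IsLayered G τ h K)
    {m : ℕ} (ρ : Fin m → DoubleRay G) {p : Fin m → ℤ} (hp : ∀ i, 0 < p i)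
    (hρ : ∀ i j, (ρ i).vertex (j + p i) = τ ((ρ i).vertex j))
    (hh : ∀ i j, h ((ρ i).vertex j) = j / p i)
    (hdisj : ∀ i j, i ≠ j → ∀ a b, (ρ i).vertex a ≠ (ρ j).vertex b)
    (hK : ∀ v, v ∈ K ↔ ∃ i, (ρ i).vertex 0 = v) : IsTauStrip G τ m := by
  classical
  have hpos : ∀ i, ∀ n : ℤ, ∀ᶠ j in atTop, n ≤ h ((ρ i).posRay.vertex j) := by
    intro i n
    filter_upwards [eventually_ge_atTop (n * p i).toNat] with j hj
    change n ≤ h ((ρ i).vertex j)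
    rw [hh, Int.le_ediv_iff_mul_le (hp i)]
    omega
  have hneg : ∀ i, ∀ n : ℤ, ∀ᶠ j in atTop, h ((ρ i).negRay.vertex j) < n := by
    intro i n
    filter_upwards [eventually_gt_atTop (-(n * p i)).toNat] with j hj
    change h ((ρ i).vertex (-j)) < n
    rw [hh, Int.ediv_lt_iff_lt_mul (hp i)]
    omega
  obtain ⟨i₀⟩ : Nonempty (Fin m) := by
    obtain ⟨k, hk⟩ := H.nonempty
    exact ⟨((hK k).1 hk).choose⟩
  have hcard : K.card = m := by
    have : K = Finset.univ.image fun i => (ρ i).vertex 0 := by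
      ext v
      simp [hK]
    rw [this, Finset.card_image_of_injective, Finset.card_univ, Fintype.card_fin]
    intro a b hab
    by_contra hne
    exact hdisj a b hne 0 0 hab
  have htop := H.isDefiningSequence_top (hpos i₀)
  have hbot := H.isDefiningSequence_bot (hneg i₀)
  -- The piece between two cuts is level zero together with the cut at the bottom of level one. It
  -- is finite, and connected by `reachable` with the single level I = {0}.
  have hY : ((K : Set V) ∪ endComponent K (ρ i₀).posRay.toEnd) \
      endComponent (imageFinset τ K) (ρ i₀).posRay.toEnd =
      {v | h v = 0 ∨ v ∈ imageFinset (τ ^ (1 : ℤ)) K} := by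
    have e0 := H.endComponent_top (hpos i₀) 0
    have e1 := H.endComponent_top (hpos i₀) 1
    have e : imageFinset (τ ^ (0 : ℤ)) K = K := by
      ext v
      simp [mem_imageFinset]
    rw [e] at e0
    rw [e0, ← zpow_one τ, e1]
    ext v
    simp only [Set.mem_sdiff, Set.mem_union, Set.mem_ofPred_eq, Finset.mem_coe, not_and, not_not]
    constructor
    · rintro ⟨hv | hv, hv'⟩
      · exact Or.inl (H.height_cut v hv)
      · by_cases hv1 : 1 ≤ h v
        · exact Or.inr (hv' hv1)
        · exact Or.inl (by omega)
    · rintro (hv | hv)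
      · refine ⟨?_, fun hv1 => absurd hv1 (by omega)⟩
        by_cases hvK : v ∈ K
        · exact Or.inl hvK
        · exact Or.inr ⟨hv.ge, hvK⟩
      · refine ⟨?_, fun _ => hv⟩
        have hv1 := H.height_of_mem_cut hv
        refine Or.inr ⟨by omega, fun hvK => ?_⟩
        have := H.height_cut v hvK
        omega
  refine ⟨⟨H.locallyFinite, H.connected, H.quasiTransitive, H.card_ends (hpos i₀) (hneg i₀)⟩,
    (ρ i₀).posRay.toEnd, (ρ i₀).negRay.toEnd, K, H.toEnd_ne (hpos i₀) (hneg i₀), ⟨?_, ?_⟩,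
    ⟨?_, ?_⟩, hcard, htop, hbot, ⟨ρ, ?_, fun i => DoubleRay.isInvariant_of_shift (hρ i), ?_⟩,
    ?_, ?_⟩
  · exact ⟨_, htop, fun n => (Finset.card_map _).trans hcard⟩
  · rintro k ⟨F, hF, hk⟩
    exact le_card_of_disjoint_rays H.connected hF hk (fun i => (ρ i).posRay)
      (fun i => toEnd_eq_iff.2 (H.equivalent_of_tendsto_top (hpos i) (hpos i₀)))
      fun i j hij a b => hdisj i j hij _ _
  · exact ⟨_, hbot, fun n => (Finset.card_map _).trans hcard⟩
  · rintro k ⟨F, hF, hk⟩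
    exact le_card_of_disjoint_rays H.connected hF hk (fun i => (ρ i).negRay)
      (fun i => toEnd_eq_iff.2 (H.equivalent_of_tendsto_bot (hneg i) (hneg i₀)))
      fun i j hij a b => hdisj i j hij _ _
  · intro i j hij
    rw [Set.disjoint_left]
    rintro _ ⟨a, rfl⟩ ⟨b, hb⟩
    exact hdisj i j hij a b hb.symm
  · intro i n
    refine ⟨(ρ i).vertex (0 + n * p i), ⟨⟨_, rfl⟩, ?_⟩, ?_⟩
    · rw [← zpow_apply_of_shift (hρ i)]
      exact mem_imageFinset.2 ⟨_, (hK _).2 ⟨i, rfl⟩, rfl⟩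
    · rintro _ ⟨⟨j, rfl⟩, hj⟩
      obtain ⟨k, hk, hkj⟩ := mem_imageFinset.1 hj
      obtain ⟨i', rfl⟩ := (hK k).1 hk
      rw [zpow_apply_of_shift (hρ i')] at hkj
      have : i' = i := by
        by_contra hne
        exact hdisj _ _ hne _ _ hkj
      subst this
      exact hkj.symm
  · rw [hY]
    exact (H.levels_finite 0 1).subset fun v hv => by
      rcases hv with hv | hv
      · constructor <;> omega
      · have := H.height_of_mem_cut hv
        constructor <;> omega
  · rw [hY]
    refine induce_connected ⟨_, Or.inl (H.height_cut _ H.nonempty.choose_spec)⟩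
      (H.reachable (I := {0}) Set.ordConnected_singleton (fun v hv _ => Or.inl hv)
        (fun v hv _ => Or.inl hv) ?_)
    rintro v (hv | hv)
    · exact Or.inl hv
    · have h1 := H.height_of_mem_cut hv
      exact Or.inr ⟨by rwa [h1], by simp [h1]⟩

theorem zpow_sub_one_apply (γ : G ≃g G) (n : ℤ) (v : V) : (γ ^ (n - 1)) (γ v) = (γ ^ n) v := by
  have := zpow_add_apply γ (n - 1) 1 v
  rwa [sub_add_cancel, zpow_one, eq_comm] at this

/-! ### Strips spanned by double rays and the translates of a finite connected set -/

theorem DoubleRay.reachable_within (ρ : DoubleRay G) {A : Set V} {a b : ℤ} (hab : a ≤ b)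
    (h : ∀ c, a ≤ c → c ≤ b → ρ.vertex c ∈ A) :
    (within G A).Reachable (ρ.vertex a) (ρ.vertex b) := by
  induction b, hab using Int.leInduction with
  | base => exact .rfl
  | succ b hb ih =>
    exact (ih fun c hc hc' => h c hc (by omega)).trans (SimpleGraph.Adj.reachable
      ⟨ρ.adj b, h b hb (by omega), h (b + 1) (by omega) le_rfl⟩)

/-- The subgraph formed by a family of double rays and all translates under `τ` of the graph
spanned by `Q`. -/
def orbitSubgraph (τ : G ≃g G) {ι : Type*} (ρ : ι → DoubleRay G) (Q : Set V) : G.Subgraph where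
  verts := {v | (∃ i j, v = (ρ i).vertex j) ∨ ∃ n : ℤ, (τ ^ n) v ∈ Q}
  Adj u v := (∃ i j, (u = (ρ i).vertex j ∧ v = (ρ i).vertex (j + 1)) ∨
      (v = (ρ i).vertex j ∧ u = (ρ i).vertex (j + 1))) ∨
    (G.Adj u v ∧ ∃ n : ℤ, (τ ^ n) u ∈ Q ∧ (τ ^ n) v ∈ Q)
  adj_sub := by
    rintro u v (⟨i, j, ⟨rfl, rfl⟩ | ⟨rfl, rfl⟩⟩ | h)
    · exact (ρ i).adj j
    · exact ((ρ i).adj j).symm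
    · exact h.1
  edge_vert := by
    rintro u v (⟨i, j, ⟨rfl, rfl⟩ | ⟨rfl, rfl⟩⟩ | ⟨-, n, hn, -⟩)
    · exact Or.inl ⟨i, j, rfl⟩
    · exact Or.inl ⟨i, j + 1, rfl⟩
    · exact Or.inr ⟨n, hn⟩
  symm := ⟨by
    rintro u v (⟨i, j, h⟩ | ⟨h, n, hu, hv⟩)
    · exact Or.inl ⟨i, j, h.symm⟩
    · exact Or.inr ⟨h.symm, n, hv, hu⟩⟩

section orbitSubgraph

variable {τ : G ≃g G} {ι : Type*} {ρ : ι → DoubleRay G} {p : ι → ℤ} {Q : Set V}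

theorem mem_verts_orbitSubgraph_iff (hρ : ∀ i j, (ρ i).vertex (j + p i) = τ ((ρ i).vertex j))
    (v : V) : v ∈ (orbitSubgraph τ ρ Q).verts ↔ τ v ∈ (orbitSubgraph τ ρ Q).verts := by
  constructor
  · rintro (⟨i, j, rfl⟩ | ⟨n, hn⟩)
    · exact Or.inl ⟨i, _, (hρ i j).symm⟩
    · refine Or.inr ⟨n - 1, ?_⟩
      rwa [zpow_sub_one_apply]
  · rintro (⟨i, j, h⟩ | ⟨n, hn⟩)
    · refine Or.inl ⟨i, j - p i, τ.injective ?_⟩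
      rw [h, ← hρ, sub_add_cancel]
    · exact Or.inr ⟨n + 1, by rwa [zpow_add_apply, zpow_one]⟩

theorem orbitSubgraph_adj_iff (hρ : ∀ i j, (ρ i).vertex (j + p i) = τ ((ρ i).vertex j))
    (u v : V) : (orbitSubgraph τ ρ Q).Adj (τ u) (τ v) ↔ (orbitSubgraph τ ρ Q).Adj u v := by
  have hρ' : ∀ i j u, τ u = (ρ i).vertex j ↔ u = (ρ i).vertex (j - p i) := by
    intro i j u
    rw [← τ.injective.eq_iff (a := u), ← hρ, sub_add_cancel]
  constructor
  · rintro (⟨i, j, h⟩ | ⟨h, n, hu, hv⟩)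
    · have e : j + 1 - p i = j - p i + 1 := by ring
      refine Or.inl ⟨i, j - p i, ?_⟩
      rwa [hρ', hρ', hρ', hρ', e] at h
    · exact Or.inr ⟨τ.map_adj_iff.1 h, n + 1, by rwa [zpow_add_apply, zpow_one],
        by rwa [zpow_add_apply, zpow_one]⟩
  · rintro (⟨i, j, h⟩ | ⟨h, n, hu, hv⟩)
    · have e : j + p i + 1 - p i = j + 1 := by ring
      refine Or.inl ⟨i, j + p i, ?_⟩
      rwa [hρ', hρ', hρ', hρ', e, add_sub_cancel_right]
    · exact Or.inr ⟨τ.map_adj_iff.2 h, n - 1, by rwa [zpow_sub_one_apply],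
        by rwa [zpow_sub_one_apply]⟩

/-- The restriction of `τ` to the orbit subgraph. -/
def orbitSubgraphIso (hρ : ∀ i j, (ρ i).vertex (j + p i) = τ ((ρ i).vertex j)) :
    (orbitSubgraph τ ρ Q).coe ≃g (orbitSubgraph τ ρ Q).coe where
  toEquiv := Equiv.subtypeEquiv τ.toEquiv (mem_verts_orbitSubgraph_iff hρ)
  map_rel_iff' := orbitSubgraph_adj_iff hρ _ _

/-- The double rays of the family, viewed in the orbit subgraph. -/
def orbitSubgraphDoubleRay (τ : G ≃g G) (ρ : ι → DoubleRay G) (Q : Set V) (i : ι) :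
    DoubleRay (orbitSubgraph τ ρ Q).coe where
  vertex j := ⟨(ρ i).vertex j, Or.inl ⟨i, j, rfl⟩⟩
  injective _ _ h := (ρ i).injective (congrArg Subtype.val h)
  adj j := Or.inl ⟨i, j, Or.inl ⟨rfl, rfl⟩⟩

end orbitSubgraph

/-- The orbit subgraph is layered, with cut K formed by the vertices of index zero. Each translate
of Q stays inside one level, so only ray edges change level, and they do so at cuts. The subgraph is
not induced, since further edges of G might join levels elsewhere. -/
theorem containsTauStrip_of_doubleRays {τ : G ≃g G} {h : V → ℤ} (hτ : ∀ v, h (τ v) = h v + 1)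
    {m : ℕ} (hm : 1 ≤ m) (ρ : Fin m → DoubleRay G) {p : Fin m → ℤ} (hp : ∀ i, 0 < p i)
    (hρ : ∀ i j, (ρ i).vertex (j + p i) = τ ((ρ i).vertex j))
    (hh : ∀ i j, h ((ρ i).vertex j) = j / p i)
    (hdisj : ∀ i j, i ≠ j → ∀ a b, (ρ i).vertex a ≠ (ρ j).vertex b)
    {Q : Finset V} (hQ : (G.induce (Q : Set V)).Connected) (hQh : ∀ q ∈ Q, h q = 0)
    (hQ0 : ∀ i, (ρ i).vertex 0 ∉ Q) (hQρ : ∀ i, ∃ j, (ρ i).vertex j ∈ Q) :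
    ContainsTauStrip G τ m := by
  classical
  set S := orbitSubgraph τ ρ (Q : Set V) with hS
  set σ : S.coe ≃g S.coe := orbitSubgraphIso hρ with hσ
  set r : Fin m → DoubleRay S.coe := orbitSubgraphDoubleRay τ ρ (Q : Set V) with hr
  set K : Finset S.verts := Finset.univ.image fun i => (r i).vertex 0 with hKdef
  have hK : ∀ v, v ∈ K ↔ ∃ i, (r i).vertex 0 = v := fun v => by simp [hKdef]
  have hrσ : ∀ i j, (r i).vertex (j + p i) = σ ((r i).vertex j) :=
    fun i j => Subtype.ext (hρ i j)
  have hrh : ∀ i j, h ((r i).vertex j : V) = j / p i := hh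
  have hzero : ∀ i j, h ((ρ i).vertex j) = 0 ↔ 0 ≤ j ∧ j < p i := by
    intro i j
    rw [hh, Int.ediv_eq_iff_of_pos (hp i), zero_mul, zero_add]
  have hQzero : ∀ v n, (τ ^ n) v ∈ Q → h v = -n := by
    intro v n hv
    have := hQh _ hv
    rw [apply_zpow_of_map hτ] at this
    omega
  have hQK : ∀ v : S.verts, (v : V) ∈ Q → v ∉ K := by
    intro v hv hvK
    obtain ⟨i, rfl⟩ := (hK v).1 hvK
    exact hQ0 i hv
  have hrK : ∀ i j, 0 < j → (r i).vertex j ∉ K := by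
    intro i j hj hjK
    obtain ⟨i', hi'⟩ := (hK _).1 hjK
    have hv : (ρ i').vertex 0 = (ρ i).vertex j := congrArg Subtype.val hi'
    by_cases hii : i' = i
    · subst hii
      exact hj.ne ((ρ i').injective hv)
    · exact hdisj _ _ hii _ _ hv
  set A : Set S.verts := {w | h (w : V) = 0 ∧ w ∉ K} with hA
  have hrA : ∀ i j, 0 < j → j < p i → (r i).vertex j ∈ A := fun i j hj hj' =>
    ⟨(hzero i j).2 ⟨hj.le, hj'⟩, hrK i j hj⟩
  have hQmem : ∀ q ∈ Q, q ∈ S.verts := fun q hq => Or.inr ⟨0, by simpa using hq⟩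
  have hQA : ∀ q (hq : q ∈ Q), (⟨q, hQmem q hq⟩ : S.verts) ∈ A := fun q hq =>
    ⟨hQh q hq, hQK _ hq⟩
  have hQreach : ∀ a (ha : a ∈ Q) b (hb : b ∈ Q),
      (within S.coe A).Reachable ⟨a, hQmem a ha⟩ ⟨b, hQmem b hb⟩ := by
    intro a ha b hb
    exact reachable_of_adj_closed (G := G.induce (Q : Set V))
      (P := fun w => (within S.coe A).Reachable ⟨a, hQmem a ha⟩ ⟨w, hQmem w w.2⟩)
      (fun c d hcd hc => hc.trans (SimpleGraph.Adj.reachable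
        ⟨Or.inr ⟨hcd, 0, by simp, by simp⟩, hQA c c.2, hQA d d.2⟩))
      (hQ.preconnected ⟨a, ha⟩ ⟨b, hb⟩) .rfl
  -- The vertex of ray i in Q has height zero and is not the cut vertex, so it lies strictly between
  -- two cuts. In particular 1 < p i, which gives every cut vertex neighbours off the cuts on both
  -- sides.
  have hp1 : ∀ i, ∃ j, 0 < j ∧ j < p i ∧ (ρ i).vertex j ∈ Q := by
    intro i
    obtain ⟨j, hj⟩ := hQρ i
    obtain ⟨hj0, hjp⟩ := (hzero i j).1 (hQh _ hj)
    refine ⟨j, lt_of_le_of_ne hj0 ?_, hjp, hj⟩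
    rintro rfl
    exact hQ0 i hj
  -- A ray vertex of level zero off the cut reaches Q along its own ray without passing a cut.
  have htoQ : ∀ v ∈ A, ∃ q, ∃ hq : q ∈ Q, (within S.coe A).Reachable v ⟨q, hQmem q hq⟩ := by
    rintro ⟨v, ⟨i, j, rfl⟩ | ⟨n, hn⟩⟩ ⟨hv0, hvK⟩
    · obtain ⟨hj0, hjp⟩ := (hzero i j).1 hv0
      have hj0 : 0 < j := by
        refine lt_of_le_of_ne hj0 ?_
        rintro rfl
        exact hvK ((hK _).2 ⟨i, rfl⟩)
      obtain ⟨j', hj0', hjp', hj'⟩ := hp1 i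
      refine ⟨_, hj', ?_⟩
      rcases le_total j j' with hle | hle
      · exact (r i).reachable_within hle fun c hc hc' => hrA i c (by omega) (by omega)
      · exact ((r i).reachable_within hle fun c hc hc' => hrA i c (by omega) (by omega)).symm
    · have hn0 : n = 0 := by
        have := hQzero v n hn
        change h v = 0 at hv0
        omega
      subst hn0
      exact ⟨v, by simpa using hn, .rfl⟩
  have hrp : ∀ i, 1 < p i := fun i => by
    obtain ⟨j, hj, hj', -⟩ := hp1 i
    omega
  -- The quotient changes only when j + 1 is a multiple of p i, that is, on entering a translate of
  -- K.
  have hcut : ∀ i j, (j + 1) / p i ≠ j / p i →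
      (j + 1) / p i = j / p i + 1 ∧ (r i).vertex (j + 1) ∈ imageFinset (σ ^ ((j + 1) / p i)) K := by
    intro i j hne
    have h1 := Int.emod_add_mul_ediv j (p i)
    have h2 := Int.emod_nonneg j (hp i).ne'
    have h3 := Int.emod_lt_of_pos j (hp i)
    have h4 : j % p i + 1 = p i := by
      by_contra h4
      apply hne
      rw [Int.ediv_eq_iff_of_pos (hp i)]
      constructor <;> nlinarith [lt_of_le_of_ne (Int.add_one_le_iff.2 h3) h4]
    have h5 : j + 1 = (j / p i + 1) * p i := by nlinarith
    have h6 : (j + 1) / p i = j / p i + 1 := by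
      conv_lhs => rw [h5]
      exact Int.mul_ediv_cancel _ (hp i).ne'
    refine ⟨h6, mem_imageFinset.2 ⟨_, (hK _).2 ⟨i, rfl⟩, ?_⟩⟩
    rw [zpow_apply_of_shift (hrσ i), h6, zero_add, ← h5]
  have hlayer : IsLayered S.coe σ (fun v => h (v : V)) K := by
    refine ⟨fun v => hτ v, ?_, ?_, ?_, ?_, ?_, ?_, ?_⟩
    · refine Set.Finite.of_finite_image (f := Subtype.val) ?_ Subtype.val_injective.injOn
      refine (Q.finite_toSet.union (Set.finite_iUnion fun i : Fin m =>
        (Set.finite_Ico 0 (p i)).image (ρ i).vertex)).subset ?_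
      rintro _ ⟨⟨v, ⟨i, j, rfl⟩ | ⟨n, hn⟩⟩, hv, rfl⟩
      · exact Or.inr (Set.mem_iUnion.2 ⟨i, j, (hzero i j).1 hv, rfl⟩)
      · have hn0 : n = 0 := by
          have := hQzero v n hn
          change h v = 0 at hv
          omega
        subst hn0
        exact Or.inl (by simpa using hn)
    · exact ⟨_, (hK _).2 ⟨⟨0, hm⟩, rfl⟩⟩
    · intro k hk
      obtain ⟨i, rfl⟩ := (hK k).1 hk
      exact (hzero i 0).2 ⟨le_rfl, hp i⟩
    · rintro ⟨u, hu⟩ ⟨v, hv⟩ (⟨i, j, ⟨hu', hv'⟩ | ⟨hv', hu'⟩⟩ | ⟨-, n, hun, hvn⟩) hle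
      · change u = _ at hu'
        change v = _ at hv'
        subst hu' hv'
        change h _ = h _ ∨ (h _ = h _ + 1 ∧ (r i).vertex (j + 1) ∈ imageFinset (σ ^ (h _)) K)
        rw [hh, hh]
        by_cases hne : (j + 1) / p i = j / p i
        · exact Or.inl hne.symm
        · exact Or.inr (hcut i j hne)
      · change u = _ at hu'
        change v = _ at hv'
        subst hu' hv'
        change h _ ≤ h _ at hle
        rw [hh, hh] at hle ⊢
        exact Or.inl (le_antisymm hle (Int.ediv_le_ediv (hp i) (by omega)))
      · exact Or.inl ((hQzero u n hun).trans (hQzero v n hvn).symm)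
    · intro u v hu huK hv hvK
      obtain ⟨a, ha, hua⟩ := htoQ u ⟨hu, huK⟩
      obtain ⟨b, hb, hvb⟩ := htoQ v ⟨hv, hvK⟩
      exact hua.trans ((hQreach a ha b hb).trans hvb.symm)
    · intro k hk
      obtain ⟨i, rfl⟩ := (hK k).1 hk
      obtain ⟨h0, h1⟩ := hrA i 1 (by omega) (hrp i)
      exact ⟨_, h0, h1, (r i).adj 0⟩
    · intro k hk
      obtain ⟨i, rfl⟩ := (hK k).1 hk
      have := hrp i
      obtain ⟨h0, h1⟩ := hrA i (p i - 1) (by omega) (by omega)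
      refine ⟨_, h0, h1, ?_⟩
      have hadj := (r i).adj (p i - 1)
      rw [sub_add_cancel, ← zero_add (p i), hrσ, zero_add] at hadj
      exact hadj.symm
  exact ⟨S, σ, fun v => rfl, hlayer.isTauStrip r hp hrσ hrh
    (fun i j hij a b hab => hdisj i j hij a b (congrArg Subtype.val hab)) hK⟩

/-! ### Automorphisms without finite orbits -/

/-- If γ ^ n fixed v, the orbit of v under γ would be a finite invariant set, with exponents reduced
modulo n. -/
theorem zpow_apply_ne_of_not_isElliptic {γ : G ≃g G} (hγ : ¬ IsElliptic γ) {n : ℤ} (hn : n ≠ 0)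
    (v : V) : (γ ^ n) v ≠ v := by
  intro hv
  apply hγ
  have hmul : ∀ k : ℤ, (γ ^ (n * k)) v = v := by
    intro k
    have := zpow_apply_of_shift (γ := γ ^ n) (L := fun _ => v) (p := 0) (fun _ => hv.symm) k 0
    rwa [← zpow_mul] at this
  have hfin : (Set.range fun k : ℤ => (γ ^ k) v).Finite := by
    refine ((Set.finite_Ico 0 |n|).image fun k : ℤ => (γ ^ k) v).subset ?_
    rintro _ ⟨k, rfl⟩
    refine ⟨k % n, ⟨Int.emod_nonneg k hn, Int.emod_lt_abs k hn⟩, ?_⟩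
    conv_rhs => rw [← Int.emod_add_mul_ediv k n]
    simp only [zpow_add_apply, hmul]
  refine ⟨hfin.toFinset, ⟨v, by simpa using ⟨0, by simp⟩⟩, ?_⟩
  ext w
  simp only [mem_imageFinset, Set.Finite.mem_toFinset, Set.mem_range]
  constructor
  · rintro ⟨_, ⟨k, rfl⟩, rfl⟩
    exact ⟨1 + k, zpow_one_add_apply γ k v⟩
  · rintro ⟨k, rfl⟩
    refine ⟨_, ⟨k - 1, rfl⟩, ?_⟩
    rw [← zpow_one_add_apply, add_sub_cancel]

theorem zpow_apply_injective {γ : G ≃g G} (hfree : ∀ n : ℤ, n ≠ 0 → ∀ v, (γ ^ n) v ≠ v) (v : V) :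
    Function.Injective fun n : ℤ => (γ ^ n) v := by
  intro a b (hab : (γ ^ a) v = (γ ^ b) v)
  by_contra hne
  refine hfree (-b + a) (by omega) v ?_
  rw [zpow_add_apply, hab, zpow_neg_apply_self]

/-- The action is free, so each vertex has a well-defined exponent relative to a chosen
representative of its orbit. -/
theorem exists_height {γ : G ≃g G} (hfree : ∀ n : ℤ, n ≠ 0 → ∀ v, (γ ^ n) v ≠ v) :
    ∃ h : V → ℤ, ∀ v, h (γ v) = h v + 1 := by
  let s : Setoid V :=
    { r := fun u v => ∃ n : ℤ, (γ ^ n) u = v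
      iseqv :=
        { refl := fun u => ⟨0, by simp⟩
          symm := by
            rintro u _ ⟨n, rfl⟩
            exact ⟨-n, zpow_neg_apply_self γ n u⟩
          trans := by
            rintro u _ _ ⟨n, rfl⟩ ⟨k, rfl⟩
            exact ⟨k + n, zpow_add_apply γ k n u⟩ } }
  have hrep : ∀ v, ∃ n : ℤ, (γ ^ n) (Quotient.mk s v).out = v := fun v => Quotient.mk_out (s := s) v
  choose h hh using hrep
  refine ⟨h, fun v => ?_⟩
  have hγ : Quotient.mk s (γ v) = Quotient.mk s v :=
    (Quotient.sound ⟨1, by rw [zpow_one]⟩ : Quotient.mk s v = Quotient.mk s (γ v)).symm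
  have h1 := hh (γ v)
  rw [hγ] at h1
  apply zpow_apply_injective hfree (Quotient.mk s v).out
  change (γ ^ h (γ v)) _ = (γ ^ (h v + 1)) _
  rw [h1, add_comm, zpow_one_add_apply, hh v]

/-- The vertex set of the rays is invariant, so the height may be prescribed on it and taken from
`exists_height` elsewhere. Disjointness makes the prescription consistent. -/
theorem exists_height_doubleRays {γ : G ≃g G} (hfree : ∀ n : ℤ, n ≠ 0 → ∀ v, (γ ^ n) v ≠ v)
    {ι : Type*} (ρ : ι → DoubleRay G) {p : ι → ℤ} (hp : ∀ i, 0 < p i)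
    (hρ : ∀ i j, (ρ i).vertex (j + p i) = γ ((ρ i).vertex j))
    (hdisj : ∀ i j, i ≠ j → ∀ a b, (ρ i).vertex a ≠ (ρ j).vertex b) :
    ∃ h : V → ℤ, (∀ v, h (γ v) = h v + 1) ∧ ∀ i j, h ((ρ i).vertex j) = j / p i := by
  obtain ⟨h₀, hh₀⟩ := exists_height hfree
  have hex : ∀ v, ∃ n : ℤ, (∀ i j, (ρ i).vertex j = v → n = j / p i) ∧
      ((¬ ∃ i j, (ρ i).vertex j = v) → n = h₀ v) := by
    intro v
    by_cases hv : ∃ i j, (ρ i).vertex j = v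
    · obtain ⟨i, j, rfl⟩ := hv
      refine ⟨j / p i, fun i' j' hij => ?_, fun hno => absurd ⟨i, j, rfl⟩ hno⟩
      obtain rfl : i' = i := by
        by_contra hne
        exact hdisj _ _ hne _ _ hij
      rw [(ρ i').injective hij]
    · exact ⟨h₀ v, fun i j hij => absurd ⟨i, j, hij⟩ hv, fun _ => rfl⟩
  choose h hh hh' using hex
  have hval : ∀ i j, h ((ρ i).vertex j) = j / p i := fun i j => hh _ i j rfl
  refine ⟨h, fun v => ?_, hval⟩
  by_cases hv : ∃ i j, (ρ i).vertex j = v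
  · obtain ⟨i, j, rfl⟩ := hv
    rw [← hρ, hval, hval, Int.add_ediv_of_dvd_right dvd_rfl, Int.ediv_self (hp i).ne']
  · have hv' : ¬ ∃ i j, (ρ i).vertex j = γ v := by
      rintro ⟨i, j, hij⟩
      refine hv ⟨i, j - p i, γ.injective ?_⟩
      rw [← hρ, sub_add_cancel, hij]
    rw [hh' _ hv, hh' _ hv', hh₀]

/-! ### Shifted double rays from shortest walks -/

theorem exists_subwalk {u v : V} (w : G.Walk u v) {a b : ℕ} (hab : a ≤ b) (hb : b ≤ w.length) :
    ∃ q : G.Walk (w.getVert a) (w.getVert b), q.length = b - a := by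
  induction b, hab using Nat.le_induction with
  | base => exact ⟨.nil, by simp⟩
  | succ b hab ih =>
    obtain ⟨q, hq⟩ := ih (by omega)
    refine ⟨q.concat (w.adj_getVert_succ (by omega)), ?_⟩
    rw [SimpleGraph.Walk.length_concat, hq]
    omega

/-- If a graph `H` preserved by the powers of a permutation with no finite orbits joins some vertex
to one of its translates, then `H` contains a double ray shifted by some power. -/
theorem exists_shifted_doubleRay {γ : G ≃g G} (hfree : ∀ n : ℤ, n ≠ 0 → ∀ v, (γ ^ n) v ≠ v)
    {H : SimpleGraph V} (hH : ∀ (n : ℤ) u v, H.Adj u v → H.Adj ((γ ^ n) u) ((γ ^ n) v))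
    {v : V} {n : ℤ} (hn : n ≠ 0) (hr : H.Reachable v ((γ ^ n) v)) :
    ∃ (ρ : DoubleRay H) (N p : ℤ), 0 < N ∧ 0 < p ∧
      ∀ j, ρ.vertex (j + p) = (γ ^ N) (ρ.vertex j) := by
  classical
  have hex : ∃ d : ℕ, ∃ (v : V) (n : ℤ), n ≠ 0 ∧ ∃ w : H.Walk v ((γ ^ n) v), w.length = d := by
    obtain ⟨w⟩ := hr
    exact ⟨_, v, n, hn, w, rfl⟩
  clear hr hn n v
  -- Take a shortest walk from any vertex to any nontrivial translate of it. Reversing it, if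
  -- necessary, makes the exponent positive.
  obtain ⟨d, ⟨v, n, hn, w, hw⟩, hmin⟩ : ∃ d : ℕ,
      (∃ (v : V) (n : ℤ), 0 < n ∧ ∃ w : H.Walk v ((γ ^ n) v), w.length = d) ∧
      ∀ (v : V) (n : ℤ), n ≠ 0 → ∀ w : H.Walk v ((γ ^ n) v), d ≤ w.length := by
    refine ⟨Nat.find hex, ?_, fun v n hn w => Nat.find_min' hex ⟨v, n, hn, w, rfl⟩⟩
    obtain ⟨v, n, hn, w, hw⟩ := Nat.find_spec hex
    rcases hn.lt_or_gt with hn | hn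
    · refine ⟨(γ ^ n) v, -n, by omega, w.reverse.copy rfl (zpow_neg_apply_self γ n v).symm, ?_⟩
      simpa using hw
    · exact ⟨v, n, hn, w, hw⟩
  have hd : 0 < d := by
    rw [← hw, Nat.pos_iff_ne_zero]
    intro h0
    exact hfree n hn.ne' v (SimpleGraph.Walk.eq_of_length_eq_zero h0).symm
  -- If a nontrivial power sent one of these vertices of the walk to another, the segment between
  -- them would be a shorter admissible walk.
  have hfix : ∀ a b : ℕ, a < d → b < d → ∀ k : ℤ, (γ ^ k) (w.getVert b) = w.getVert a → k = 0 := by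
    intro a b ha hb k hk
    by_contra hk0
    have : ∃ q : H.Walk (w.getVert b) (w.getVert a), q.length < d := by
      rcases le_total a b with hab | hab
      · obtain ⟨q, hq⟩ := exists_subwalk w hab (by omega)
        exact ⟨q.reverse, by rw [SimpleGraph.Walk.length_reverse]; omega⟩
      · obtain ⟨q, hq⟩ := exists_subwalk w hab (by omega)
        exact ⟨q, by omega⟩
    obtain ⟨q, hq⟩ := this
    have := hmin _ k hk0 (q.copy rfl hk.symm)
    rw [SimpleGraph.Walk.length_copy] at this
    omega
  have hne : ∀ a b : ℕ, a < b → b < d → w.getVert a ≠ w.getVert b := by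
    intro a b hab hb heq
    obtain ⟨q, hq⟩ := exists_subwalk w (Nat.zero_le a) (by omega)
    obtain ⟨q', hq'⟩ := exists_subwalk w (show b ≤ d by omega) hw.ge
    have := hmin v n hn.ne' ((q.append (q'.copy heq.symm rfl)).copy w.getVert_zero
      (by rw [← hw, w.getVert_length]))
    rw [SimpleGraph.Walk.length_copy, SimpleGraph.Walk.length_append,
      SimpleGraph.Walk.length_copy] at this
    omega
  have hd' : (0 : ℤ) < d := by exact_mod_cast hd
  -- Concatenate the translates of w under the powers of γ ^ n: the index j lies in translate number
  -- j / d, at position j % d.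
  let f : ℤ → V := fun j => (γ ^ (n * (j / d))) (w.getVert (j % d).toNat)
  have hmod : ∀ j : ℤ, (j % d).toNat < d := fun j => by
    have := Int.emod_lt_of_pos j hd'
    omega
  refine ⟨⟨f, ?_, ?_⟩, n, d, hn, hd', ?_⟩
  · intro i j hij
    have hij : (γ ^ (n * (i / d))) (w.getVert (i % d).toNat) =
      (γ ^ (n * (j / d))) (w.getVert (j % d).toNat) := hij
    have hk := hfix _ _ (hmod j) (hmod i) (-(n * (j / d)) + n * (i / d))
      (by rw [zpow_add_apply, hij, zpow_neg_apply_self])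
    have hdiv : i / d = j / d := by
      apply mul_left_cancel₀ hn.ne'
      omega
    rw [hdiv] at hij
    have hij := (γ ^ (n * (j / d))).injective hij
    have hmodeq : i % d = j % d := by
      have hi := Int.emod_nonneg i hd'.ne'
      have hj := Int.emod_nonneg j hd'.ne'
      rcases lt_trichotomy (i % d).toNat (j % d).toNat with h | h | h
      · exact absurd hij (hne _ _ h (hmod j))
      · omega
      · exact absurd hij.symm (hne _ _ h (hmod i))
    rw [← Int.emod_add_mul_ediv i d, ← Int.emod_add_mul_ediv j d, hdiv, hmodeq]
  · intro j
    have hj0 := Int.emod_nonneg j hd'.ne'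
    have hj1 := Int.emod_lt_of_pos j hd'
    have hj2 := Int.emod_add_mul_ediv j d
    have hadj := hH (n * (j / d)) _ _ (w.adj_getVert_succ (i := (j % d).toNat) (by
      rw [hw]; exact hmod j))
    have hsucc : f (j + 1) = (γ ^ (n * (j / d))) (w.getVert ((j % d).toNat + 1)) := by
      by_cases hlast : (j % d) + 1 = d
      · have e : j + 1 = d * (j / d + 1) := by linarith
        have e1 : (j + 1) / d = j / d + 1 := by
          rw [e]
          conv_lhs => rw [Int.mul_ediv_cancel_left _ hd'.ne']
        have e2 : (j + 1) % d = 0 := Int.emod_eq_zero_of_dvd ⟨_, e⟩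
        have e3 : (j % d).toNat + 1 = w.length := by omega
        change (γ ^ (n * ((j + 1) / d))) (w.getVert ((j + 1) % d).toNat) = _
        rw [e1, e2, e3, w.getVert_length, ← zpow_add_apply]
        simp [mul_add]
      · have e1 : (j + 1) / d = j / d := by
          rw [Int.ediv_eq_iff_of_pos hd']
          constructor <;> nlinarith [lt_of_le_of_ne (Int.add_one_le_iff.2 hj1) hlast]
        have e2 : (j + 1) % d = j % d + 1 := by
          have := Int.emod_add_mul_ediv (j + 1) d
          rw [e1] at this
          linarith
        change (γ ^ (n * ((j + 1) / d))) (w.getVert ((j + 1) % d).toNat) = _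
        rw [e1, e2]
        congr 2
        omega
    rw [hsucc]
    exact hadj
  · intro j
    change (γ ^ (n * ((j + d) / d))) (w.getVert ((j + d) % d).toNat) =
      (γ ^ n) ((γ ^ (n * (j / d))) (w.getVert (j % d).toNat))
    rw [Int.add_ediv_of_dvd_right dvd_rfl, Int.ediv_self hd'.ne', Int.add_emod_right,
      ← zpow_add_apply]
    congr 2
    ring

/-! ### Both ends of a shifted double ray of a parabolic automorphism agree -/

/-- A fixed path from γ (r a) to r a is moved off any finite set F by γ ^ (c * k) for all large k.
The p starting indices a cover the whole ray, so it and its image under γ are eventually joined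
outside F. -/
theorem map_toEnd_of_shift (hG : G.Connected) {γ : G ≃g G}
    (hfree : ∀ n : ℤ, n ≠ 0 → ∀ v, (γ ^ n) v ≠ v) (r : Ray G) {c : ℤ} (hc : c ≠ 0) {p : ℕ}
    (hp : 0 < p) (hr : ∀ n, r.vertex (n + p) = (γ ^ c) (r.vertex n)) :
    GraphEnd.map γ r.toEnd = r.toEnd := by
  change (r.map γ).toEnd = r.toEnd
  refine toEnd_eq_iff.2 (equivalent_of_eventually fun F => ?_)
  have hout : ∀ w, ∀ᶠ k : ℕ in atTop, (γ ^ (c * k)) w ∈ (F : Set V)ᶜ := by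
    intro w
    have hinj : Function.Injective fun k : ℕ => (γ ^ (c * (k : ℤ))) w := fun a b hab => by
      have := mul_left_cancel₀ hc (zpow_apply_injective hfree w hab)
      exact_mod_cast this
    have := hinj.tendsto_cofinite.eventually F.finite_toSet.compl_mem_cofinite
    rwa [Nat.cofinite_eq_atTop] at this
  have hreach : ∀ u v, ∀ᶠ k : ℕ in atTop,
      (within G (F : Set V)ᶜ).Reachable ((γ ^ (c * k)) u) ((γ ^ (c * k)) v) := fun u v =>
    reachable_of_adj_closed (P := fun w => ∀ᶠ k : ℕ in atTop,
      (within G (F : Set V)ᶜ).Reachable ((γ ^ (c * k)) u) ((γ ^ (c * k)) w))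
      (fun a b hab ha => by
        filter_upwards [ha, hout a, hout b] with k hk hka hkb
        exact hk.trans (SimpleGraph.Adj.reachable
          ⟨(γ ^ (c * (k : ℤ))).map_adj_iff.2 hab, hka, hkb⟩))
      (hG.preconnected u v) (Eventually.of_forall fun _ => .rfl)
  have hall : ∀ᶠ k : ℕ in atTop, ∀ a : Fin p, (within G (F : Set V)ᶜ).Reachable
      ((γ ^ (c * k)) (γ (r.vertex a))) ((γ ^ (c * k)) (r.vertex a)) :=
    eventually_all.2 fun a => hreach _ _
  have hshift : ∀ (k a : ℕ), r.vertex (a + p * k) = (γ ^ (c * k)) (r.vertex a) := by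
    intro k a
    induction k with
    | zero => simp
    | succ k ih =>
      have e : c * ((k + 1 : ℕ) : ℤ) = c + c * k := by push_cast; ring
      rw [e, zpow_add_apply, ← ih, ← hr]
      congr 1
      ring
  filter_upwards [(Nat.tendsto_div_const_atTop hp.ne').eventually hall] with n hn
  have := hn ⟨n % p, Nat.mod_lt n hp⟩
  have e : (γ ^ (c * ((n / p : ℕ) : ℤ))) (γ (r.vertex (n % p))) =
      γ ((γ ^ (c * ((n / p : ℕ) : ℤ))) (r.vertex (n % p))) := by
    rw [← zpow_one_add_apply, add_comm, zpow_add_apply, zpow_one]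
  simp only [e, ← hshift, Nat.mod_add_div] at this
  exact this

/-- The two tails are shifted by γ ^ N and γ ^ (-N), so both ends are fixed by γ, and the fixed end
is unique. -/
theorem equivalent_posRay_negRay (hG : G.Connected) {γ : G ≃g G} (hγ : IsParabolic γ)
    (ρ : DoubleRay G) {N p : ℤ} (hN : 0 < N) (hp : 0 < p)
    (hρ : ∀ j, ρ.vertex (j + p) = (γ ^ N) (ρ.vertex j)) : ρ.posRay.Equivalent ρ.negRay := by
  have hfree : ∀ n : ℤ, n ≠ 0 → ∀ v, (γ ^ n) v ≠ v :=
    fun n hn v => zpow_apply_ne_of_not_isElliptic hγ.1 hn v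
  obtain ⟨q, rfl⟩ := Int.eq_ofNat_of_zero_le hp.le
  have hq : 0 < q := by exact_mod_cast hp
  refine toEnd_eq_iff.1 (hγ.2.unique ?_ ?_)
  · refine map_toEnd_of_shift hG hfree _ hN.ne' hq fun n => ?_
    change ρ.vertex ((n + q : ℕ) : ℤ) = (γ ^ N) (ρ.vertex n)
    rw [← hρ]
    push_cast
    rfl
  · refine map_toEnd_of_shift hG hfree _ (neg_ne_zero.2 hN.ne') hq fun n => ?_
    change ρ.vertex (-((n + q : ℕ) : ℤ)) = (γ ^ (-N)) (ρ.vertex (-n))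
    apply (γ ^ N).injective
    rw [zpow_apply_neg_self, ← hρ]
    congr 1
    push_cast
    ring

/-! ### Translates reachable outside a set of finitely many orbits -/

/-- Let `A` be an invariant set of vertices with finitely many vertices of each height, containing
a shifted double ray of a parabolic automorphism. Then some vertex is joined to one of its
translates outside `A`. -/
theorem exists_reachable_translate_compl (hlf : IsLocallyFinite G) (hG : G.Connected) {γ : G ≃g G}
    (hγ : IsParabolic γ) {h : V → ℤ} (hh : ∀ v, h (γ v) = h v + 1) {A : Set V}
    (hA : ∀ (n : ℤ), ∀ v ∈ A, (γ ^ n) v ∈ A) (hfin : {v | v ∈ A ∧ h v = 0}.Finite)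
    (ρ : DoubleRay G) {N p : ℤ} (hN : 0 < N) (hp : 0 < p)
    (hρ : ∀ j, ρ.vertex (j + p) = (γ ^ N) (ρ.vertex j)) (hρA : ∀ j, ρ.vertex j ∈ A) :
    ∃ v, ∃ n : ℤ, n ≠ 0 ∧ (within G Aᶜ).Reachable v ((γ ^ n) v) ∧ v ∉ A := by
  by_contra! hno
  have hno : ∀ (v : V) (n : ℤ), v ∉ A → (within G Aᶜ).Reachable v ((γ ^ n) v) → n = 0 := by
    intro v n hv hr
    by_contra hn
    exact hv (hno v n hn hr)
  have hhz := apply_zpow_of_map hh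
  have hAc : ∀ (n : ℤ), ∀ v ∈ Aᶜ, (γ ^ n) v ∈ Aᶜ := by
    intro n v hv hv'
    have := hA (-n) _ hv'
    rw [zpow_neg_apply_self] at this
    exact hv this
  -- A component of the complement attaches to finitely many vertices of A: moving each attaching
  -- edge so that its end in A has height zero leaves finitely many edges, and two with the same
  -- image would give a component containing a nontrivial translate of one of its vertices.
  have hcomp : ∀ c, c ∉ A →
      {b | b ∈ A ∧ ∃ c', (within G Aᶜ).Reachable c c' ∧ G.Adj b c'}.Finite := by
    intro c hc
    set E := {b | b ∈ A ∧ ∃ c', (within G Aᶜ).Reachable c c' ∧ G.Adj b c'} with hE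
    have : ∀ b, ∃ c', b ∈ E → (within G Aᶜ).Reachable c c' ∧ G.Adj b c' := by
      intro b
      by_cases hb : b ∈ E
      · exact ⟨hb.2.choose, fun _ => hb.2.choose_spec⟩
      · exact ⟨b, fun hb' => absurd hb' hb⟩
    choose f hf using this
    refine Set.Finite.of_injOn (f := fun b => ((γ ^ (-h b)) b, (γ ^ (-h b)) (f b)))
      (t := ⋃ z ∈ {v | v ∈ A ∧ h v = 0}, (fun y => (z, y)) '' G.neighborSet z) ?_ ?_
      (hfin.biUnion fun z _ => (hlf z).image _)
    · intro b hb
      refine Set.mem_biUnion (x := (γ ^ (-h b)) b) ⟨hA _ b hb.1, by rw [hhz]; ring⟩ ⟨_, ?_, rfl⟩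
      exact (γ ^ (-h b)).map_adj_iff.2 (hf b hb).2
    · intro a ha b hb hab
      simp only [Prod.mk.injEq] at hab
      obtain ⟨h1, h2⟩ := hab
      have hca := (hf a ha).1
      have hcb := (hf b hb).1
      have hfa : f a ∈ Aᶜ := within_reachable_mem hca hc
      have e : f b = (γ ^ (h b + -h a)) (f a) := by
        rw [zpow_add_apply, h2, zpow_apply_neg_self]
      have h0 := hno (f a) (h b + -h a) hfa (e ▸ hca.symm.trans hcb)
      have h3 : h a = h b := by omega
      rw [h3] at h1
      exact (γ ^ (-h b)).injective h1
  -- Two vertices of A are related when they are adjacent or attach to a common component of the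
  -- complement. By invariance and finiteness, related vertices differ in height by less than a
  -- constant M.
  let rel : V → V → Prop := fun a b => G.Adj a b ∨
    ∃ c c', c ∉ A ∧ G.Adj a c ∧ (within G Aᶜ).Reachable c c' ∧ G.Adj b c'
  have hrelfin : ∀ a, {b | b ∈ A ∧ rel a b}.Finite := by
    intro a
    refine ((hlf a).union (((hlf a).inter_of_left Aᶜ).biUnion fun c hc => hcomp c hc.2)).subset ?_
    rintro b ⟨hb, hab | ⟨c, c', hc, hac, hcc', hbc'⟩⟩
    · exact Or.inl hab
    · exact Or.inr (Set.mem_biUnion (x := c) ⟨hac, hc⟩ ⟨hb, c', hcc', hbc'⟩)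
  have hrelγ : ∀ (n : ℤ) a b, rel a b → rel ((γ ^ n) a) ((γ ^ n) b) := by
    rintro n a b (hab | ⟨c, c', hc, hac, hcc', hbc'⟩)
    · exact Or.inl ((γ ^ n).map_adj_iff.2 hab)
    · exact Or.inr ⟨_, _, hAc n c hc, (γ ^ n).map_adj_iff.2 hac,
        within_reachable_map (γ ^ n) (hAc n) hcc', (γ ^ n).map_adj_iff.2 hbc'⟩
  obtain ⟨M, hM0, hM⟩ : ∃ M : ℤ, 0 ≤ M ∧ ∀ a ∈ A, ∀ b ∈ A, rel a b → |h b - h a| < M := by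
    obtain ⟨M, hM0, hM⟩ := exists_height_bound (hfin.biUnion fun a _ => hrelfin a).toFinset h
    refine ⟨M, hM0, fun a ha b hb hab => ?_⟩
    have := hM ((γ ^ (-h a)) b) (by
      rw [Set.Finite.mem_toFinset]
      exact Set.mem_biUnion (x := (γ ^ (-h a)) a) ⟨hA _ a ha, by rw [hhz]; ring⟩
        ⟨hA _ b hb, hrelγ _ _ _ hab⟩)
    rw [hhz] at this
    rw [abs_lt]
    constructor <;> linarith [this.1, this.2]
  have hlevel : ∀ n : ℤ, {v | v ∈ A ∧ h v = n}.Finite := by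
    intro n
    refine (hfin.image (γ ^ n)).subset ?_
    rintro v ⟨hv, rfl⟩
    exact ⟨(γ ^ (-h v)) v, ⟨hA _ v hv, by rw [hhz]; ring⟩, zpow_apply_neg_self γ _ v⟩
  have hKfin : {v | v ∈ A ∧ |h v| ≤ M}.Finite := by
    refine ((Set.finite_Icc (-M) M).biUnion fun n _ => hlevel n).subset fun v hv => ?_
    exact Set.mem_biUnion (x := h v) (abs_le.1 hv.2) ⟨hv.1, rfl⟩
  -- The upper side: vertices of A above height M, and components attached to them. A related pair
  -- cannot jump across the band |h| ≤ M, so U is closed under adjacency outside that finite band.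
  let U : Set V := {v | (v ∈ A ∧ M < h v) ∨
    (v ∉ A ∧ ∃ c' b, (within G Aᶜ).Reachable v c' ∧ G.Adj b c' ∧ b ∈ A ∧ M < h b)}
  have hUcl : ∀ v ∈ U, ∀ w, ¬ (w ∈ A ∧ |h w| ≤ M) → G.Adj v w → w ∈ U := by
    intro v hv w hw hvw
    have hbig : ∀ a ∈ A, M < h a → rel a w → w ∈ A → w ∈ U := by
      intro a ha hMa haw hwA
      refine Or.inl ⟨hwA, ?_⟩
      have h1 := abs_lt.1 (hM a ha w hwA haw)
      by_contra hlt
      refine hw ⟨hwA, abs_le.2 ⟨?_, ?_⟩⟩ <;> omega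
    rcases hv with ⟨hvA, hvM⟩ | ⟨hvA, c', b, hc', hbc', hbA, hbM⟩
    · by_cases hwA : w ∈ A
      · exact hbig v hvA hvM (Or.inl hvw) hwA
      · exact Or.inr ⟨hwA, w, v, .rfl, hvw, hvA, hvM⟩
    · by_cases hwA : w ∈ A
      · exact hbig b hbA hbM
          (Or.inr ⟨c', v, within_reachable_mem hc' hvA, hbc', hc'.symm, hvw.symm⟩) hwA
      · exact Or.inr ⟨hwA, c', b,
          (SimpleGraph.Adj.reachable (G := within G Aᶜ) ⟨hvw.symm, hwA, hvA⟩).trans hc',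
          hbc', hbA, hbM⟩
  obtain ⟨C, hC, hC'⟩ := equivalent_posRay_negRay hG hγ ρ hN hp hρ hKfin.toFinset
  have htend : Tendsto (fun k : ℕ => p.toNat * k) atTop atTop :=
    tendsto_id.const_mul_atTop' (by omega)
  have hρh : ∀ k : ℤ, h (ρ.vertex (p * k)) = h (ρ.vertex 0) + N * k := by
    intro k
    rw [← hhz, zpow_mul, zpow_apply_of_shift hρ]
    congr 2
    ring
  obtain ⟨k, hk, hk', hkbig⟩ := ((htend.eventually hC).and ((htend.eventually hC').and
    (eventually_gt_atTop (M + |h (ρ.vertex 0)|).toNat))).exists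
  have hcast : ((p.toNat * k : ℕ) : ℤ) = p * k := by
    push_cast
    rw [Int.toNat_of_nonneg hp.le]
  change ρ.vertex ((p.toNat * k : ℕ) : ℤ) ∈ C at hk
  change ρ.vertex (-((p.toNat * k : ℕ) : ℤ)) ∈ C at hk'
  have hNk : (k : ℤ) ≤ N * k := by nlinarith
  have habs := abs_le.1 (le_refl |h (ρ.vertex 0)|)
  rw [hcast] at hk hk'
  rw [← mul_neg] at hk'
  have htop : ρ.vertex (p * k) ∈ U := by
    refine Or.inl ⟨hρA _, ?_⟩
    rw [hρh]
    omega
  have hbot : ρ.vertex (p * -k) ∈ U := by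
    refine reachable_of_adj_closed (G := within G ((hKfin.toFinset : Finset V) : Set V)ᶜ)
      (P := (· ∈ U)) (fun a b hab ha => hUcl a ha b ?_ hab.1)
      (reachable_of_mem_component hk hk') htop
    simpa using hab.2.2
  rcases hbot with ⟨-, hlt⟩ | ⟨hn, -⟩
  · rw [hρh, mul_neg] at hlt
    omega
  · exact hn (hρA _)

/-! ### Families of disjoint shifted double rays -/

/-- A double ray of a spanning subgraph, viewed in the larger graph. -/
def DoubleRay.ofLE {H : SimpleGraph V} (ρ : DoubleRay H) (h : H ≤ G) : DoubleRay G where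
  vertex := ρ.vertex
  injective := ρ.injective
  adj n := h (ρ.adj n)

/-- The set A to be avoided contains the translates of the rays under γ itself, not just γ ^ N. This
makes its complement γ-invariant, so that translates of a walk outside A stay outside A. -/
theorem exists_shifted_doubleRay_of_disjoint (hlf : IsLocallyFinite G) (hG : G.Connected)
    {γ : G ≃g G} (hγ : IsParabolic γ) {m : ℕ} (ρ : Fin m → DoubleRay G) {N : ℤ} (hN : 0 < N)
    {p : Fin m → ℤ} (hp : ∀ i, 0 < p i)
    (hρ : ∀ i j, (ρ i).vertex (j + p i) = (γ ^ N) ((ρ i).vertex j)) :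
    ∃ (r : DoubleRay G) (N' p' : ℤ), 0 < N' ∧ 0 < p' ∧
      (∀ j, r.vertex (j + p') = (γ ^ N') (r.vertex j)) ∧
      ∀ i a b, (ρ i).vertex a ≠ r.vertex b := by
  have hfree : ∀ n : ℤ, n ≠ 0 → ∀ v, (γ ^ n) v ≠ v :=
    fun n hn v => zpow_apply_ne_of_not_isElliptic hγ.1 hn v
  obtain ⟨h, hh⟩ := exists_height hfree
  set A : Set V := {v | ∃ i j, ∃ n : ℤ, v = (γ ^ n) ((ρ i).vertex j)} with hAdef
  have hA : ∀ (n : ℤ), ∀ v ∈ A, (γ ^ n) v ∈ A := by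
    rintro n _ ⟨i, j, k, rfl⟩
    exact ⟨i, j, n + k, (zpow_add_apply γ n k _).symm⟩
  have hAc : ∀ (n : ℤ), ∀ v ∈ Aᶜ, (γ ^ n) v ∈ Aᶜ := by
    intro n v hv hv'
    have := hA (-n) _ hv'
    rw [zpow_neg_apply_self] at this
    exact hv this
  have hρA : ∀ i j, (ρ i).vertex j ∈ A := fun i j => ⟨i, j, 0, by simp⟩
  -- One period of each ray represents all orbits in A, and each orbit has exactly one vertex of
  -- height zero.
  have hfin : {v | v ∈ A ∧ h v = 0}.Finite := by
    refine (Set.finite_iUnion fun i : Fin m => (Set.finite_Ico 0 (p i)).image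
      fun j => (γ ^ (-h ((ρ i).vertex j))) ((ρ i).vertex j)).subset ?_
    rintro _ ⟨⟨i, j, n, rfl⟩, hv⟩
    refine Set.mem_iUnion.2 ⟨i, j % p i, ⟨Int.emod_nonneg j (hp i).ne',
      Int.emod_lt_of_pos j (hp i)⟩, ?_⟩
    have hj : (ρ i).vertex j = (γ ^ (N * (j / p i))) ((ρ i).vertex (j % p i)) := by
      rw [zpow_mul, zpow_apply_of_shift (hρ i)]
      congr 1
      have := Int.emod_add_mul_ediv j (p i)
      linarith
    rw [hj, ← zpow_add_apply] at hv ⊢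
    rw [apply_zpow_of_map hh] at hv
    change (γ ^ (-h ((ρ i).vertex (j % p i)))) ((ρ i).vertex (j % p i)) = _
    congr 2
    omega
  obtain ⟨v, n, hn, hr, hv⟩ :
      ∃ v, ∃ n : ℤ, n ≠ 0 ∧ (within G Aᶜ).Reachable v ((γ ^ n) v) ∧ v ∉ A := by
    rcases Nat.eq_zero_or_pos m with rfl | hm
    · obtain ⟨v⟩ := hG.nonempty
      have hAe : A = ∅ := by
        ext w
        simp [hAdef]
      refine ⟨v, 1, one_ne_zero, (hG.preconnected _ _).mono fun a b hab => ?_, by simp [hAe]⟩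
      exact ⟨hab, by simp [hAe], by simp [hAe]⟩
    · exact exists_reachable_translate_compl hlf hG hγ hh hA hfin (ρ ⟨0, hm⟩) hN (hp _) (hρ _)
        (hρA _)
  obtain ⟨r, N', p', hN', hp', hr'⟩ := exists_shifted_doubleRay hfree (H := within G Aᶜ)
    (fun n a b hab => ⟨(γ ^ n).map_adj_iff.2 hab.1, hAc n a hab.2.1, hAc n b hab.2.2⟩) hn hr
  refine ⟨r.ofLE fun a b hab => hab.1, N', p', hN', hp', hr', fun i a b hab => ?_⟩
  exact (r.adj b).2.1 (hab ▸ hρA i a)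

theorem exists_disjoint_shifted_doubleRays (hlf : IsLocallyFinite G) (hG : G.Connected)
    {γ : G ≃g G} (hγ : IsParabolic γ) (m : ℕ) :
    ∃ (ρ : Fin m → DoubleRay G) (N : ℤ) (p : Fin m → ℤ), 0 < N ∧ (∀ i, 0 < p i) ∧
      (∀ i j, (ρ i).vertex (j + p i) = (γ ^ N) ((ρ i).vertex j)) ∧
      ∀ i j, i ≠ j → ∀ a b, (ρ i).vertex a ≠ (ρ j).vertex b := by
  induction m with
  | zero => exact ⟨Fin.elim0, 1, Fin.elim0, one_pos, fun i => i.elim0, fun i => i.elim0,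
      fun i => i.elim0⟩
  | succ m ih =>
    obtain ⟨ρ, N, p, hN, hp, hρ, hdisj⟩ := ih
    obtain ⟨r, N', p', hN', hp', hr, hrdisj⟩ :=
      exists_shifted_doubleRay_of_disjoint hlf hG hγ ρ hN hp hρ
    -- Passing to the common power γ ^ (N * N') multiplies the period of r by N and those of the old
    -- rays by N'.
    refine ⟨Fin.cons r ρ, N * N', Fin.cons (N * p') fun i => N' * p i, by positivity, ?_, ?_, ?_⟩
    · refine Fin.cases ?_ fun i => ?_
      · simp only [Fin.cons_zero]
        positivity
      · have := hp i
        simp only [Fin.cons_succ]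
        positivity
    · refine Fin.cases ?_ fun i => ?_ <;> intro j
      · simp only [Fin.cons_zero]
        rw [mul_comm N N', zpow_mul, zpow_apply_of_shift hr]
      · simp only [Fin.cons_succ]
        rw [zpow_mul, zpow_apply_of_shift (hρ i)]
    · refine Fin.cases ?_ fun i => ?_ <;> refine Fin.cases ?_ fun j => ?_
      · exact fun hne => absurd rfl hne
      · intro _ a b hab
        exact hrdisj j b a hab.symm
      · intro _ a b hab
        exact hrdisj i a b hab
      · intro hne a b
        exact hdisj i j (fun hij => hne (congrArg _ hij)) a b

/-- A finite connected Q meeting all rays has heights strictly between -B and B. The rays are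
reindexed to start at height -B, and levels are formed from blocks of 2 * B consecutive heights:
then Q lies in level zero and misses the cut, and γ ^ (2 * B) moves levels up by one. -/
theorem containsTauStrip_of_shifted_doubleRays (hG : G.Connected) {γ : G ≃g G}
    (hfree : ∀ n : ℤ, n ≠ 0 → ∀ v, (γ ^ n) v ≠ v) {m : ℕ} (hm : 1 ≤ m) (ρ : Fin m → DoubleRay G)
    {p : Fin m → ℤ} (hp : ∀ i, 0 < p i)
    (hρ : ∀ i j, (ρ i).vertex (j + p i) = γ ((ρ i).vertex j))
    (hdisj : ∀ i j, i ≠ j → ∀ a b, (ρ i).vertex a ≠ (ρ j).vertex b) :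
    ∃ k : ℤ, ContainsTauStrip G (γ ^ k) m := by
  classical
  obtain ⟨h, hh, hhρ⟩ := exists_height_doubleRays hfree ρ hp hρ hdisj
  obtain ⟨Q, hQρ, hQ⟩ := SimpleGraph.extend_finset_to_connected hG.preconnected
    (t := Finset.univ.image fun i => (ρ i).vertex 0) ⟨(ρ ⟨0, hm⟩).vertex 0, by simp⟩
  have hQρ : ∀ i, (ρ i).vertex 0 ∈ Q := fun i => hQρ (by simp)
  obtain ⟨B, -, hB⟩ := exists_height_bound Q h
  have hB0 : 0 < B := by
    have := hB _ (hQρ ⟨0, hm⟩)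
    omega
  have hk : 0 < 2 * B := by omega
  let σ : Fin m → DoubleRay G := fun i =>
    { vertex := fun j => (ρ i).vertex (j + -B * p i)
      injective := (ρ i).injective.comp (add_left_injective _)
      adj := fun j => by
        have := (ρ i).adj (j + -B * p i)
        rwa [add_right_comm] at this }
  have hσh : ∀ i j, h ((σ i).vertex j) + B = j / p i := by
    intro i j
    change h ((ρ i).vertex (j + -B * p i)) + B = _
    rw [hhρ, Int.add_mul_ediv_right _ _ (hp i).ne', neg_add_cancel_right]
  refine ⟨2 * B, containsTauStrip_of_doubleRays (h := fun v => (h v + B) / (2 * B))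
    (fun v => ?_) hm σ (p := fun i => 2 * B * p i) (fun i => mul_pos hk (hp i)) ?_ ?_ ?_ hQ ?_ ?_
    ?_⟩
  · rw [apply_zpow_of_map hh, add_right_comm, Int.add_ediv_of_dvd_right dvd_rfl,
      Int.ediv_self hk.ne']
  · intro i j
    change (ρ i).vertex (j + 2 * B * p i + -B * p i) = (γ ^ (2 * B)) ((ρ i).vertex (j + -B * p i))
    rw [zpow_apply_of_shift (hρ i), add_right_comm]
  · intro i j
    rw [hσh, Int.ediv_ediv_of_nonneg (hp i).le, mul_comm (p i)]
  · exact fun i j hij a b => hdisj i j hij _ _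
  · intro q hq
    have := hB q hq
    exact Int.ediv_eq_zero_of_lt (by omega) (by omega)
  · intro i hi
    have h1 := hB _ hi
    have h2 := hσh i 0
    rw [Int.zero_ediv] at h2
    omega
  · intro i
    -- After reindexing, this is the original vertex of index zero, which was put into Q.
    refine ⟨B * p i, ?_⟩
    change (ρ i).vertex (B * p i + -B * p i) ∈ Q
    rw [neg_mul, add_neg_cancel]
    exact hQρ i

end GraphStrip

theorem lemma3p4 {V : Type*} (X : SimpleGraph V) (hlf : GraphStrip.IsLocallyFinite X)
    (hconn : X.Connected) (Γ : Subgroup (X ≃g X)) (hqt : GraphStrip.ActsQuasiTransitively Γ)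
    (hpar : ∃ γ ∈ Γ, GraphStrip.IsParabolic γ) :
    ∀ m : ℕ, 1 ≤ m → ∃ τ ∈ Γ, ∃ n : ℕ, m ≤ n ∧ GraphStrip.ContainsTauStrip X τ n := by
  intro m hm
  obtain ⟨γ, hγΓ, hγ⟩ := hpar
  obtain ⟨ρ, N, p, hN, hp, hρ, hdisj⟩ :=
    GraphStrip.exists_disjoint_shifted_doubleRays hlf hconn hγ m
  obtain ⟨k, hk⟩ := GraphStrip.containsTauStrip_of_shifted_doubleRays hconn (γ := γ ^ N)
    (fun n hn v => by
      rw [← zpow_mul]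
      exact GraphStrip.zpow_apply_ne_of_not_isElliptic hγ.1 (mul_ne_zero hN.ne' hn) v)
    hm ρ hp hρ hdisj
  exact ⟨_, Γ.zpow_mem (Γ.zpow_mem hγΓ N) k, m, le_rfl, hk⟩
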